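/- For every integer $n\ge 1$ there are constants $c(n)\in(0,1)$ and $C(n)>0$, depending only on $n$, with the following property. Let $r_0>0$, let $u:B_{r_0}(0)\subset\mathbb{R}^2=\mathbb{C}\to\mathbb{R}$ be a non-constant harmonic function with a boundary value in $L^1$ of the circle $|z|=r_0$ (that is, $u(re^{i\theta})$ converges in $L^1(d\theta)$ to some $g\in L^1$ as $r\uparrow r_0$), and let $p\in B_{r_0}(0)$ with $u(p)=0$. Call the maximal regular real-analytic curves contained in the nodal set $Z(u)=\{z\in B_{r_0}(0): u(z)=0\}$ the nodal curves of $u$. Assume that $u$ vanishes at $p$ to order exactly $n$, and that $Z(u)$ consists of exactly $n$ nodal curves, all of which pass through $p$. Let $$\psi(z)=e^{i\alpha}\,\frac{r_0(z-p)}{r_0^2-\overline{p}z}\qquad(\alpha\in\mathbb{R})$$ be a Möbius map of $B_{r_0}(0)$ onto $B_1(0)$ with $\psi(p)=0$. Then for every point $z\in (Z(u)\setminus\{p\})\cap\psi^{-1}(B_{c(n)}(0))$ the curvature $\kappa(u)(z)$ at $z$ of the nodal curve through $z$ satisfies $$|\kappa(u)(z)|\le \frac{C(n)\,r_0}{r_0^2-|p|^2}.$$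 -/

import Mathlib

open Set Filter Topology MeasureTheory

/-- The nodal set `Z(u)` of a function `u` on the region `D`. -/
def nodalSet (u : ℂ → ℝ) (D : Set ℂ) : Set ℂ :=
  {z | z ∈ D ∧ u z = 0}

/-- A regular real-analytic curve lying in the nodal set of `u` in `D`. Every open interval is
real-analytically diffeomorphic to `ℝ`, so the parameter interval is taken to be `ℝ`. -/
structure IsRegularAnalyticCurveIn (u : ℂ → ℝ) (D : Set ℂ) (γ : ℝ → ℂ) : Prop where
  analytic : AnalyticOnNhd ℝ γ univ
  regular : ∀ t, deriv γ t ≠ 0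
  subset_nodalSet : range γ ⊆ nodalSet u D

/-- A nodal curve of `u` in `D` (with a parametrization): a maximal regular real-analytic curve
in the nodal set. -/
structure IsNodalCurve (u : ℂ → ℝ) (D : Set ℂ) (γ : ℝ → ℂ) : Prop
    extends IsRegularAnalyticCurveIn u D γ where
  maximal : ∀ δ : ℝ → ℂ, IsRegularAnalyticCurveIn u D δ → range γ ⊆ range δ → range δ = range γ

/-- The nodal set of `u` in `D` is composed of exactly `n` (distinct) nodal curves, and all of
them pass through `p`. -/
def HasOnlyNodalCurvesThrough (u : ℂ → ℝ) (D : Set ℂ) (p : ℂ) (n : ℕ) : Prop :=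
  ∃ γ : Fin n → ℝ → ℂ,
    (∀ k, IsNodalCurve u D (γ k)) ∧
    (Function.Injective fun k => range (γ k)) ∧
    (∀ k, p ∈ range (γ k)) ∧
    nodalSet u D = ⋃ k, range (γ k)

/-- `u` vanishes at `p` to order exactly `n`: `∇ᵏu(p) = 0` for `k < n` and `∇ⁿu(p) ≠ 0`. -/
def HasVanishingOrder (u : ℂ → ℝ) (p : ℂ) (n : ℕ) : Prop :=
  (∀ k < n, iteratedFDeriv ℝ k u p = 0) ∧ iteratedFDeriv ℝ n u p ≠ 0

/-- `u` has a boundary value `g` in `L¹` of the circle of radius `r₀` about the origin: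
`u(r e^{iθ}) → g(θ)` in `L¹` as `r ↑ r₀`. -/
def HasL1BoundaryValue (u : ℂ → ℝ) (r₀ : ℝ) : Prop :=
  ∃ g : ℝ → ℝ, IntervalIntegrable g volume 0 (2 * Real.pi) ∧
    Tendsto (fun r : ℝ => ∫ θ in (0 : ℝ)..(2 * Real.pi), |u (circleMap 0 r θ) - g θ|)
      (𝓝[<] r₀) (𝓝 0)

/-- The signed curvature `(x' y'' - y' x'') / |γ'|³` of the plane curve `γ = x + i y` at `t`. -/
noncomputable def signedCurvature (γ : ℝ → ℂ) (t : ℝ) : ℝ :=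
  ((deriv γ t).re * (deriv (deriv γ) t).im - (deriv γ t).im * (deriv (deriv γ) t).re)
    / ‖deriv γ t‖ ^ 3

/-- The Möbius map of the disc of radius `r₀` onto the unit disc that sends `p` to `0`; for
`r₀ = 1` it is `z ↦ e^{iα} (z - p) / (1 - conj p * z)`. -/
noncomputable def discMobius (r₀ : ℝ) (p : ℂ) (α : ℝ) (z : ℂ) : ℂ :=
  Complex.exp (α * Complex.I) * (r₀ * (z - p) / ((r₀ : ℂ) ^ 2 - (starRingEnd ℂ) p * z))

/-! Write `u = Re F` with `F` holomorphic and `F p = 0`. The nodal hypothesis is used in this form: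
every zero of `u` is joined to `p` by a regular analytic curve inside the nodal set. Topology. By
the maximum principle a compact piece of the nodal set does not separate the plane, so the winding
integral of a cycle inside it is constant off the cycle. That integral jumps by `2πi` across a point
visited once, at a regular time, so such points do not exist
(`false_of_simple_point_of_re_eq_zero`). Hence nodal curves are injective, and no zero of `u` other
than `p` is critical: a transversal branch there, joined back to `p`, would close a forbidden cycle
(`deriv_ne_zero_of_nodal`). Consequently `Im F` is strictly monotone along each arc leaving `p`.
Points with `F = is`, `s > 0`, can then be followed down to `p`, where `F` is the `n`-th power of a
coordinate, so there are at most `n` of them (`card_le_of_nodal`). Value distribution. On the unit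
disc, with `p` moved to `0`, the function becomes `f = wⁿ exp H`. After normalisation on a small
disc, Jensen's formula for `f - is` with a well-chosen `s ∈ [2, 3]` bounds the mean of `log⁺ |f|` in
terms of `n`. Poisson's formula turns this into an upper bound for `Re H`, and Borel–Carathéodory
with Cauchy's estimates bounds `H'` and `H''` near `0` (`exists_bound_deriv_exponent`). Curvature.
Since `F` is imaginary along a nodal curve, the curvature is at most `|F''/F' - l F'/F|` for every
real `l` (`abs_signedCurvature_le`). For `l = (n-1)/n` the simple poles at the zero of order `n`
cancel, and what remains is controlled by `H'` and `H''` (`norm_pow_mul_exp_quotient_le`). Returning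
to the original disc costs only `ψ''/ψ'` and a factor `ψ'`, which supply the scale `r₀ / (r₀² -
|p|²)`. -/

/-! ### Compact parts of the nodal set do not separate the plane -/

theorem isPreconnected_compl_closedBall_zero (R : ℝ) :
    IsPreconnected (Metric.closedBall (0 : ℂ) R)ᶜ := by
  have h : (Metric.closedBall (0 : ℂ) R)ᶜ =
      (fun x : ℝ × ℝ => (x.1 : ℂ) * Complex.exp (x.2 * Complex.I)) '' (Ioi R ×ˢ univ) := by
    ext z
    simp only [mem_compl_iff, Metric.mem_closedBall, dist_zero_right, not_le, mem_image, mem_prod,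
      mem_Ioi, mem_univ, and_true, Prod.exists]
    constructor
    · intro hz
      exact ⟨‖z‖, z.arg, hz, Complex.norm_mul_exp_arg_mul_I z⟩
    · rintro ⟨a, b, hab, rfl⟩
      rw [norm_mul, Complex.norm_exp_ofReal_mul_I, mul_one, Complex.norm_real]
      exact hab.trans_le (le_abs_self a)
  rw [h]
  refine (isPreconnected_Ioi.prod isPreconnected_univ).image _ (Continuous.continuousOn ?_)
  fun_prop

/-- A holomorphic function on a disc whose real part is not constant is not locally constant. -/
theorem not_eventually_eq_const_of_re_not_const {F : ℂ → ℂ} {R : ℝ}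
    (hF : AnalyticOnNhd ℂ F (Metric.ball 0 R))
    (hnc : ¬ ∃ a : ℝ, ∀ z ∈ Metric.ball (0 : ℂ) R, (F z).re = a) {q : ℂ}
    (hq : q ∈ Metric.ball (0 : ℂ) R) (c : ℂ) : ¬ ∀ᶠ z in 𝓝 q, F z = c := by
  intro h
  have := hF.eqOn_of_preconnected_of_eventuallyEq (g := fun _ => c)
    (fun _ _ => analyticAt_const) (convex_ball (0 : ℂ) R).isPreconnected hq h
  exact hnc ⟨c.re, fun z hz => by rw [this hz]⟩

/-- Open mapping: the image of a neighbourhood of `q` would contain `F q + t` for small real `t >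
0`, whose real part is not zero. -/
theorem not_eventually_re_eq_zero {F : ℂ → ℂ} {R : ℝ}
    (hF : AnalyticOnNhd ℂ F (Metric.ball 0 R))
    (hnc : ¬ ∃ a : ℝ, ∀ z ∈ Metric.ball (0 : ℂ) R, (F z).re = a) {q : ℂ}
    (hq : q ∈ Metric.ball (0 : ℂ) R) : ¬ ∀ᶠ z in 𝓝 q, (F z).re = 0 := by
  intro h
  rcases (hF q hq).eventually_constant_or_nhds_le_map_nhds with h1 | h1
  · exact not_eventually_eq_const_of_re_not_const hF hnc hq _ h1
  · have h2 : ∀ᶠ w in 𝓝 (F q), w.re = 0 := h1 (show _ ∈ map F (𝓝 q) from h)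
    have h3 : Tendsto (fun t : ℝ => F q + t) (𝓝[>] 0) (𝓝 (F q)) := by
      have : ContinuousAt (fun t : ℝ => F q + t) 0 := by fun_prop
      have := this.tendsto
      simp only [Complex.ofReal_zero, add_zero] at this
      exact this.mono_left nhdsWithin_le_nhds
    have h4 := (h3.eventually h2).and self_mem_nhdsWithin
    obtain ⟨t, ht, ht0⟩ := h4.exists
    have h5 := h.self_of_nhds
    simp [h5] at ht
    exact (ne_of_gt ht0) ht

/-- By the maximum principle, compact subsets of the zero set of a nonconstant harmonic function
on a disc do not separate the plane. -/
theorem isPreconnected_compl_of_re_eq_zero {F : ℂ → ℂ} {R : ℝ}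
    (hF : AnalyticOnNhd ℂ F (Metric.ball 0 R))
    (hnc : ¬ ∃ a : ℝ, ∀ z ∈ Metric.ball (0 : ℂ) R, (F z).re = a) {K : Set ℂ}
    (hK : IsCompact K) (hKR : K ⊆ Metric.ball 0 R) (hK0 : ∀ z ∈ K, (F z).re = 0) :
    IsPreconnected Kᶜ := by
  rcases le_or_gt R 0 with hR0 | hR0
  · rw [Metric.ball_eq_empty.2 hR0, subset_empty_iff] at hKR
    simpa [hKR] using isPreconnected_univ
  obtain ⟨R', hR', hKR'⟩ : ∃ R' ∈ Ico 0 R, K ⊆ Metric.closedBall 0 R' := by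
    rcases K.eq_empty_or_nonempty with rfl | hne
    · exact ⟨0, ⟨le_rfl, hR0⟩, empty_subset _⟩
    · obtain ⟨x, hx, hxm⟩ := hK.exists_isMaxOn hne continuous_norm.continuousOn
      exact ⟨‖x‖, ⟨norm_nonneg x, by simpa using hKR hx⟩, fun y hy => by simpa using hxm hy⟩
  set E := (Metric.closedBall (0 : ℂ) R')ᶜ with hE
  have hEpre : IsPreconnected E := isPreconnected_compl_closedBall_zero R'
  have hEK : E ⊆ Kᶜ := compl_subset_compl.2 hKR'
  have hopen : IsOpen Kᶜ := hK.isClosed.isOpen_compl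
  -- It suffices that every component of `Kᶜ` reaches the connected exterior `E`. A component `U`
  -- missing `E` would be bounded, with frontier in `K`, where `Re F = 0`.
  have key : ∀ a ∈ Kᶜ, (connectedComponentIn Kᶜ a ∩ E).Nonempty := by
    intro a ha
    by_contra hcon
    set U := connectedComponentIn Kᶜ a with hU
    have hUo : IsOpen U := hopen.connectedComponentIn
    have haU : a ∈ U := mem_connectedComponentIn ha
    have hUb : U ⊆ Metric.closedBall 0 R' := by
      intro z hz
      by_contra hz'
      exact hcon ⟨z, hz, hz'⟩
    have hUcl : closure U ⊆ Metric.closedBall 0 R' :=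
      closure_minimal hUb Metric.isClosed_closedBall
    have hclR : closure U ⊆ Metric.ball 0 R :=
      hUcl.trans (Metric.closedBall_subset_ball hR'.2)
    have hfr : frontier U ⊆ K := by
      intro z hz
      by_contra hzK
      have hzo : IsOpen (connectedComponentIn Kᶜ z) := hopen.connectedComponentIn
      obtain ⟨w, hw1, hw2⟩ := mem_closure_iff.1 hz.1 _ hzo (mem_connectedComponentIn hzK)
      have e1 := connectedComponentIn_eq hw1
      have e2 := connectedComponentIn_eq hw2
      have : z ∈ U := by rw [hU, e2, ← e1]; exact mem_connectedComponentIn hzK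
      exact hz.2 (by rwa [hUo.interior_eq])
    have hbd : Bornology.IsBounded U := Metric.isBounded_closedBall.subset hUb
    have hd : DifferentiableOn ℂ F (closure U) := hF.differentiableOn.mono hclR
    -- Both `exp F` and `exp (-F)` have modulus `1` on the frontier, so the maximum modulus
    -- principle bounds `Re F` from either side.
    have h1 : ∀ z ∈ U, (F z).re ≤ 0 := by
      intro z hz
      have := Complex.norm_le_of_forall_mem_frontier_norm_le (f := fun z => Complex.exp (F z))
        (C := 1) hbd (DifferentiableOn.diffContOnCl hd.cexp)
        (fun w hw => by simp [Complex.norm_exp, hK0 w (hfr hw)]) (subset_closure hz)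
      simpa [Complex.norm_exp] using this
    have h2 : ∀ z ∈ U, 0 ≤ (F z).re := by
      intro z hz
      have := Complex.norm_le_of_forall_mem_frontier_norm_le (f := fun z => Complex.exp (-F z))
        (C := 1) hbd (DifferentiableOn.diffContOnCl hd.neg.cexp)
        (fun w hw => by simp [Complex.norm_exp, hK0 w (hfr hw)]) (subset_closure hz)
      simpa [Complex.norm_exp] using this
    refine not_eventually_re_eq_zero hF hnc (hclR (subset_closure haU)) ?_
    filter_upwards [hUo.mem_nhds haU] with z hz using le_antisymm (h1 z hz) (h2 z hz)
  have hx0 : ((R' + 1 : ℝ) : ℂ) ∈ E := by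
    simp only [hE, mem_compl_iff, Metric.mem_closedBall, dist_zero_right, Complex.norm_real, not_le]
    exact (lt_add_one R').trans_le (le_abs_self _)
  refine isPreconnected_of_forall _ fun y hy =>
    ⟨connectedComponentIn Kᶜ y ∪ E, union_subset (connectedComponentIn_subset _ _) hEK,
      Or.inr hx0, Or.inl (mem_connectedComponentIn hy), ?_⟩
  obtain ⟨w, hw1, hw2⟩ := key y hy
  exact IsPreconnected.union w hw1 hw2 isPreconnected_connectedComponentIn hEpre

/-! ### Winding integrals and points visited once -/

/-- If the quotient equals `-r` with `r ≥ 0`, then `z = (x + r y) / (1 + r)` lies on the segment.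
Hence the principal logarithm of the quotient is a primitive of `1/(z - x) - 1/(z - y)` off the
segment. -/
theorem div_sub_mem_slitPlane {x y z : ℂ} (hz : z ∉ segment ℝ x y) :
    (z - x) / (z - y) ∈ Complex.slitPlane := by
  have hzy : z - y ≠ 0 := fun h => hz (by rw [sub_eq_zero.1 h]; exact right_mem_segment ℝ x y)
  rw [Complex.mem_slitPlane_iff_not_le_zero]
  intro hle
  obtain ⟨r, hr⟩ : ∃ r : ℝ, (z - x) / (z - y) = -r := by
    refine ⟨-((z - x) / (z - y)).re, Complex.ext (by simp) ?_⟩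
    simpa using (Complex.le_def.1 hle).2
  have hr0 : 0 ≤ r := by
    have := (Complex.le_def.1 hle).1
    rw [hr] at this
    simpa using this
  rw [div_eq_iff hzy] at hr
  have h1 : (1 + r : ℂ) ≠ 0 := by exact_mod_cast (by positivity : (1 + r : ℝ) ≠ 0)
  refine hz ⟨1 / (1 + r), r / (1 + r), by positivity, by positivity, by field_simp, ?_⟩
  simp only [Complex.real_smul]
  push_cast
  field_simp
  linear_combination -hr

theorem hasDerivAt_log_div_sub {σ : ℝ → ℂ} {σ' x y : ℂ} {t : ℝ} (h : HasDerivAt σ σ' t)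
    (hz : σ t ∉ segment ℝ x y) :
    HasDerivAt (fun t => Complex.log ((σ t - x) / (σ t - y)))
      (σ' / (σ t - x) - σ' / (σ t - y)) t := by
  have hzy : σ t - y ≠ 0 := fun h => hz (by rw [sub_eq_zero.1 h]; exact right_mem_segment ℝ x y)
  have hzx : σ t - x ≠ 0 := fun h => hz (by rw [sub_eq_zero.1 h]; exact left_mem_segment ℝ x y)
  have h0 : HasDerivAt (fun t => (σ t - x) / (σ t - y)) _ t :=
    (h.sub_const x).div (h.sub_const y) hzy
  convert h0.clog_real (div_sub_mem_slitPlane hz) using 1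
  field_simp

theorem intervalIntegrable_div_sub {σ σ' : ℝ → ℂ} {a b : ℝ} {x : ℂ}
    (hd : ContinuousOn σ (uIcc a b)) (hc : ContinuousOn σ' (uIcc a b))
    (hx : ∀ t ∈ uIcc a b, σ t ≠ x) :
    IntervalIntegrable (fun t => σ' t / (σ t - x)) volume a b :=
  (hc.div (hd.sub continuousOn_const) fun t ht => sub_ne_zero.2 (hx t ht)).intervalIntegrable

/-- The right side depends only on the endpoints of the path, so it cancels when summed over a
cycle. -/
theorem integral_div_sub_sub_of_disjoint_segment {σ σ' : ℝ → ℂ} {a b : ℝ} {x y : ℂ}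
    (hd : ∀ t ∈ uIcc a b, HasDerivAt σ (σ' t) t) (hc : ContinuousOn σ' (uIcc a b))
    (hz : ∀ t ∈ uIcc a b, σ t ∉ segment ℝ x y) :
    (∫ t in a..b, σ' t / (σ t - x)) - ∫ t in a..b, σ' t / (σ t - y) =
      Complex.log ((σ b - x) / (σ b - y)) - Complex.log ((σ a - x) / (σ a - y)) := by
  have hσ : ContinuousOn σ (uIcc a b) := fun t ht => (hd t ht).continuousAt.continuousWithinAt
  have hix := intervalIntegrable_div_sub (x := x) hσ hc
    fun t ht h => hz t ht (h ▸ left_mem_segment ℝ x y)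
  have hiy := intervalIntegrable_div_sub (x := y) hσ hc
    fun t ht h => hz t ht (h ▸ right_mem_segment ℝ x y)
  rw [← intervalIntegral.integral_sub hix hiy]
  exact intervalIntegral.integral_eq_sub_of_hasDerivAt
    (fun t ht => hasDerivAt_log_div_sub (hd t ht) (hz t ht)) (hix.sub hiy)

/-- For `ε > 0` the sign is opposite to that of `ζ.re`; it decides from which side of the branch cut
the quotient tends to `-1`. -/
theorem im_div_sub_add {ζ : ℂ} {ε : ℝ} :
    ((ζ - Complex.I * ε) / (ζ + Complex.I * ε)).im =
      -(2 * ε * ζ.re) / Complex.normSq (ζ + Complex.I * ε) := by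
  rw [Complex.div_im]
  simp
  ring

/-- The integral of `dz / (z - x)` along a path jumps by `2πi` as `x` crosses the path. -/
theorem integral_div_sub_sub_of_crossing {σ σ' : ℝ → ℂ} {a b τ ε : ℝ}
    (ha : a < τ) (hb : τ < b) (hε : 0 < ε)
    (hd : ∀ t ∈ Icc a b, HasDerivAt σ (σ' t) t) (hc : ContinuousOn σ' (Icc a b))
    (hne : σ' τ ≠ 0) (hlt : ∀ᶠ t in 𝓝[<] τ, ((σ t - σ τ) / σ' τ).re < 0)
    (hgt : ∀ᶠ t in 𝓝[>] τ, 0 < ((σ t - σ τ) / σ' τ).re)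
    {x y : ℂ} (hx : x = σ τ + Complex.I * ε * σ' τ) (hy : y = σ τ - Complex.I * ε * σ' τ)
    (hz : ∀ t ∈ Icc a b, t ≠ τ → σ t ∉ segment ℝ x y) :
    (∫ t in a..b, σ' t / (σ t - x)) - ∫ t in a..b, σ' t / (σ t - y) =
      Complex.log ((σ b - x) / (σ b - y)) - Complex.log ((σ a - x) / (σ a - y))
        + 2 * Real.pi * Complex.I := by
  have hI : Complex.I * ε ≠ 0 := by simp [hε.ne']
  have hσ : ContinuousOn σ (Icc a b) := fun t ht => (hd t ht).continuousAt.continuousWithinAt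
  have hxτ : σ τ ≠ x := by
    intro h; rw [hx] at h; exact mul_ne_zero hI hne (by linear_combination -h)
  have hyτ : σ τ ≠ y := by
    intro h; rw [hy] at h; exact mul_ne_zero hI hne (by linear_combination h)
  have hxt : ∀ t ∈ Icc a b, σ t ≠ x := by
    intro t ht h
    by_cases htτ : t = τ
    · exact hxτ (htτ ▸ h)
    · exact hz t ht htτ (h ▸ left_mem_segment ℝ x y)
  have hyt : ∀ t ∈ Icc a b, σ t ≠ y := by
    intro t ht h
    by_cases htτ : t = τ
    · exact hyτ (htτ ▸ h)
    · exact hz t ht htτ (h ▸ right_mem_segment ℝ x y)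
  -- In the coordinate `(σ t - σ τ) / σ' τ` the tangent is the real axis and `x`, `y` are `±iε`. The
  -- quotient reaches `-1` from above before `τ` and from below after it, so the logarithm tends to
  -- `πi` and then to `-πi`; the difference is the jump.
  have hquot : ∀ t, (σ t - x) / (σ t - y) =
      ((σ t - σ τ) / σ' τ - Complex.I * ε) / ((σ t - σ τ) / σ' τ + Complex.I * ε) := by
    intro t
    conv_rhs => rw [← mul_div_mul_right _ _ hne]
    rw [hx, hy]
    congr 1 <;> (field_simp; ring)
  have hlim : Tendsto (fun t => (σ t - x) / (σ t - y)) (𝓝 τ) (𝓝 (-1)) := by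
    have h1 : ContinuousAt (fun t => (σ t - x) / (σ t - y)) τ :=
      ((hd τ ⟨ha.le, hb.le⟩).continuousAt.sub continuousAt_const).div
        ((hd τ ⟨ha.le, hb.le⟩).continuousAt.sub continuousAt_const) (sub_ne_zero.2 hyτ)
    have h2 : (σ τ - x) / (σ τ - y) = -1 := by
      rw [hquot]; simp [hε.ne']
    rw [← h2]; exact h1.tendsto
  have hposn : ∀ t ∈ Icc a b, 0 < Complex.normSq ((σ t - σ τ) / σ' τ + Complex.I * ε) := by
    intro t ht
    rw [Complex.normSq_pos]
    intro h
    refine sub_ne_zero.2 (hyt t ht) ?_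
    have : σ t - y = ((σ t - σ τ) / σ' τ + Complex.I * ε) * σ' τ := by
      rw [hy]; field_simp; ring
    rw [this, h, zero_mul]
  have hIcc : Icc a b ∈ 𝓝 τ := Icc_mem_nhds ha hb
  have hleft : Tendsto (fun t => Complex.log ((σ t - x) / (σ t - y))) (𝓝[<] τ)
      (𝓝 (Real.pi * Complex.I)) := by
    have h1 := Complex.tendsto_log_nhdsWithin_im_nonneg_of_re_neg_of_im_zero (z := -1)
      (by simp) (by simp)
    simp only [norm_neg, norm_one, Real.log_one, Complex.ofReal_zero, zero_add] at h1
    refine h1.comp (tendsto_nhdsWithin_iff.2 ⟨hlim.mono_left nhdsWithin_le_nhds, ?_⟩)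
    filter_upwards [hlt, nhdsWithin_le_nhds hIcc] with t ht ht2
    rw [hquot, im_div_sub_add]
    exact div_nonneg (by nlinarith) (hposn t ht2).le
  have hright : Tendsto (fun t => Complex.log ((σ t - x) / (σ t - y))) (𝓝[>] τ)
      (𝓝 (-(Real.pi * Complex.I))) := by
    have h1 := Complex.tendsto_log_nhdsWithin_im_neg_of_re_neg_of_im_zero (z := -1)
      (by simp) (by simp)
    simp only [norm_neg, norm_one, Real.log_one, Complex.ofReal_zero, zero_sub] at h1
    refine h1.comp (tendsto_nhdsWithin_iff.2 ⟨hlim.mono_left nhdsWithin_le_nhds, ?_⟩)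
    filter_upwards [hgt, nhdsWithin_le_nhds hIcc] with t ht ht2
    rw [hquot, im_div_sub_add]
    exact div_neg_of_neg_of_pos (by nlinarith) (hposn t ht2)
  have hab : uIcc a b = Icc a b := uIcc_of_le (ha.trans hb).le
  have hix := intervalIntegrable_div_sub (a := a) (b := b) (x := x) (hab ▸ hσ) (hab ▸ hc)
    (hab ▸ hxt)
  have hiy := intervalIntegrable_div_sub (a := a) (b := b) (x := y) (hab ▸ hσ) (hab ▸ hc)
    (hab ▸ hyt)
  have hi := hix.sub hiy
  have hτ : τ ∈ uIcc a b := hab ▸ ⟨ha.le, hb.le⟩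
  have hi1 := hi.mono_set (c := a) (d := τ) (uIcc_subset_uIcc left_mem_uIcc hτ)
  have hi2 := hi.mono_set (c := τ) (d := b) (uIcc_subset_uIcc hτ right_mem_uIcc)
  have hdl : ∀ t ∈ Icc a b, t ≠ τ → HasDerivAt
      (fun t => Complex.log ((σ t - x) / (σ t - y)))
      (σ' t / (σ t - x) - σ' t / (σ t - y)) t := fun t ht htτ =>
    hasDerivAt_log_div_sub (hd t ht) (hz t ht htτ)
  rw [← intervalIntegral.integral_sub hix hiy,
    ← intervalIntegral.integral_add_adjacent_intervals hi1 hi2,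
    intervalIntegral.integral_eq_sub_of_hasDerivAt_of_tendsto ha
      (fun t ht => hdl t ⟨ht.1.le, (ht.2.trans hb).le⟩ ht.2.ne) hi1
      ((hdl a ⟨le_rfl, (ha.trans hb).le⟩ ha.ne).continuousAt.tendsto.mono_left
        nhdsWithin_le_nhds) hleft,
    intervalIntegral.integral_eq_sub_of_hasDerivAt_of_tendsto hb
      (fun t ht => hdl t ⟨(ha.trans ht.1).le, ht.2.le⟩ ht.1.ne') hi2 hright
      ((hdl b ⟨(ha.trans hb).le, le_rfl⟩ hb.ne').continuousAt.tendsto.mono_left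
        nhdsWithin_le_nhds)]
  ring

theorem eventually_re_div_pos {σ : ℝ → ℂ} {e : ℂ} {τ : ℝ} (h : HasDerivAt σ e τ) (he : e ≠ 0) :
    (∀ᶠ t in 𝓝[<] τ, ((σ t - σ τ) / e).re < 0) ∧ ∀ᶠ t in 𝓝[>] τ, 0 < ((σ t - σ τ) / e).re := by
  have h1 : HasDerivAt (fun t => ((σ t - σ τ) / e).re) 1 τ := by
    have h2 : HasDerivAt (fun t => (σ t - σ τ) / e) 1 τ := by
      simpa [he] using (h.sub_const (σ τ)).div_const e
    simpa [Function.comp_def] using Complex.reCLM.hasFDerivAt.comp_hasDerivAt τ h2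
  have h3 := hasDerivAt_iff_tendsto_slope.1 h1
  have h4 : ∀ᶠ t in 𝓝[≠] τ, 0 < slope (fun t => ((σ t - σ τ) / e).re) τ t :=
    h3.eventually (lt_mem_nhds one_pos)
  simp only [slope_def_field, sub_self, zero_div, Complex.zero_re, sub_zero] at h4
  constructor
  · filter_upwards [nhdsWithin_mono τ (fun t (ht : t < τ) => ht.ne) h4, self_mem_nhdsWithin]
      with t ht1 ht2
    rcases div_pos_iff.1 ht1 with h | h
    · exact absurd h.2 (not_lt.2 (sub_nonpos.2 (le_of_lt ht2)))
    · exact h.1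
  · filter_upwards [nhdsWithin_mono τ (fun t (ht : τ < t) => ht.ne') h4, self_mem_nhdsWithin]
      with t ht1 ht2
    rcases div_pos_iff.1 ht1 with h | h
    · exact h.1
    · exact absurd h.2 (not_lt.2 (sub_nonneg.2 (le_of_lt ht2)))

/-- A `C¹` cycle whose support does not separate the plane has no point that is visited exactly
once, at a regular interior time. -/
theorem false_of_simple_point {ι : Type*} [Fintype ι] {σ σ' : ι → ℝ → ℂ} {a b : ι → ℝ}
    (hd : ∀ i, ∀ t ∈ uIcc (a i) (b i), HasDerivAt (σ i) (σ' i t) t)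
    (hc : ∀ i, ContinuousOn (σ' i) (uIcc (a i) (b i)))
    (hcyc : ∀ g : ℂ → ℂ, ∑ i, (g (σ i (b i)) - g (σ i (a i))) = 0)
    (hpre : IsPreconnected (⋃ i, σ i '' uIcc (a i) (b i))ᶜ)
    {j : ι} {τ : ℝ} (hτ : τ ∈ Ioo (min (a j) (b j)) (max (a j) (b j))) (hne : σ' j τ ≠ 0)
    (hsimple : ∀ i, ∀ t ∈ uIcc (a i) (b i), σ i t = σ j τ → i = j ∧ t = τ) : False := by
  classical
  set K := ⋃ i, σ i '' uIcc (a i) (b i) with hK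
  have hcont : ∀ i, ContinuousOn (σ i) (uIcc (a i) (b i)) := fun i t ht =>
    (hd i t ht).continuousAt.continuousWithinAt
  have hKc : IsCompact K := isCompact_iUnion fun i => isCompact_uIcc.image_of_continuousOn (hcont i)
  have hKo : IsOpen Kᶜ := hKc.isClosed.isOpen_compl
  -- Up to the factor `2πi`, this is the winding number of the cycle. It is locally constant on the
  -- connected open set `Kᶜ`, hence constant there.
  set I : ℂ → ℂ := fun x => ∑ i, ∫ t in (a i)..(b i), σ' i t / (σ i t - x) with hI
  have hmemK : ∀ i, ∀ t ∈ uIcc (a i) (b i), σ i t ∈ K := fun i t ht =>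
    mem_iUnion.2 ⟨i, t, ht, rfl⟩
  have hloc : ∀ x y, segment ℝ x y ⊆ Kᶜ → I x = I y := by
    intro x y hxy
    rw [← sub_eq_zero, hI]
    simp only
    rw [← Finset.sum_sub_distrib, ← hcyc fun z => Complex.log ((z - x) / (z - y))]
    exact Finset.sum_congr rfl fun i _ => integral_div_sub_sub_of_disjoint_segment (hd i) (hc i)
      fun t ht h => hxy h (hmemK i t ht)
  have hder : ∀ x ∈ Kᶜ, HasDerivAt I 0 x := by
    intro x hx
    obtain ⟨r, hr, hrK⟩ := Metric.isOpen_iff.1 hKo x hx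
    refine (hasDerivAt_const x (I x)).congr_of_eventuallyEq ?_
    filter_upwards [Metric.ball_mem_nhds x hr] with y hy
    exact hloc y x (((convex_ball x r).segment_subset hy (Metric.mem_ball_self hr)).trans hrK)
  have hconst : ∀ x ∈ Kᶜ, ∀ y ∈ Kᶜ, I x = I y := fun x hx y hy =>
    hKo.is_const_of_deriv_eq_zero hpre
      (fun z hz => (hder z hz).differentiableAt.differentiableWithinAt)
      (fun z hz => (hder z hz).deriv) hx hy
  have hτu : τ ∈ uIcc (a j) (b j) := ⟨hτ.1.le, hτ.2.le⟩
  set w := σ j τ with hw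
  set e := σ' j τ with he
  obtain ⟨hlt, hgt⟩ := eventually_re_div_pos (hd j τ hτu) hne
  have hreal : ∀ᶠ t in 𝓝[≠] τ, ((σ j t - w) / e).re ≠ 0 := by
    rw [← Iio_union_Ioi, nhdsWithin_union]
    exact eventually_sup.2 ⟨hlt.mono fun t h => h.ne, hgt.mono fun t h => h.ne'⟩
  obtain ⟨δ, hδ, hδt⟩ : ∃ δ > 0, ∀ t ∈ Metric.ball τ δ, t ≠ τ → ((σ j t - w) / e).re ≠ 0 := by
    obtain ⟨δ, hδ, h⟩ := Metric.eventually_nhds_iff_ball.1 (eventually_nhdsWithin_iff.1 hreal)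
    exact ⟨δ, hδ, h⟩
  have hsegre : ∀ ε : ℝ, ∀ z ∈ segment ℝ (w + Complex.I * ε * e) (w - Complex.I * ε * e),
      ((z - w) / e).re = 0 := by
    rintro ε z ⟨p, q, -, -, hpq, rfl⟩
    have hpq' : (p : ℂ) + q = 1 := by exact_mod_cast hpq
    have : (p • (w + Complex.I * ε * e) + q • (w - Complex.I * ε * e) - w) / e
        = Complex.I * ((p - q) * ε : ℝ) := by
      rw [div_eq_iff hne]
      simp only [Complex.real_smul]
      push_cast
      linear_combination w * hpq'
    rw [this]
    simp
  -- Outside the window around `τ` the cycle keeps a positive distance from `w`, since `w` is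
  -- visited once; inside the window it meets the normal line at `w` only at time `τ`. A short
  -- normal segment therefore meets `K` only at `w`.
  have hfar : ∀ᶠ ε : ℝ in 𝓝[>] 0, ∀ i, ∀ t ∈ uIcc (a i) (b i) \ (if i = j then Metric.ball τ δ else ∅),
      σ i t ∉ segment ℝ (w + Complex.I * ε * e) (w - Complex.I * ε * e) := by
    refine eventually_all.2 fun i => ?_
    set C := σ i '' (uIcc (a i) (b i) \ (if i = j then Metric.ball τ δ else ∅)) with hC
    have hCc : IsCompact C := by
      refine (isCompact_uIcc.diff ?_).image_of_continuousOn ((hcont i).mono sdiff_subset)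
      split_ifs
      · exact Metric.isOpen_ball
      · exact isOpen_empty
    have hwC : w ∈ Cᶜ := by
      rintro ⟨t, ht, htw⟩
      obtain ⟨rfl, rfl⟩ := hsimple i t ht.1 htw
      exact ht.2 (by simp [hδ])
    obtain ⟨r, hr, hrC⟩ := Metric.isOpen_iff.1 hCc.isClosed.isOpen_compl w hwC
    have h1 : ∀ᶠ ε : ℝ in 𝓝[>] 0, w + Complex.I * ε * e ∈ Metric.ball w r := by
      have : ContinuousAt (fun ε : ℝ => w + Complex.I * ε * e) 0 := by fun_prop
      exact nhdsWithin_le_nhds (this.preimage_mem_nhds (by simpa using Metric.ball_mem_nhds w hr))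
    have h2 : ∀ᶠ ε : ℝ in 𝓝[>] 0, w - Complex.I * ε * e ∈ Metric.ball w r := by
      have : ContinuousAt (fun ε : ℝ => w - Complex.I * ε * e) 0 := by fun_prop
      exact nhdsWithin_le_nhds (this.preimage_mem_nhds (by simpa using Metric.ball_mem_nhds w hr))
    filter_upwards [h1, h2] with ε h1 h2 t ht hmem
    exact hrC ((convex_ball w r).segment_subset h1 h2 hmem) ⟨t, ht, rfl⟩
  obtain ⟨ε, hεfar, hε⟩ := (hfar.and self_mem_nhdsWithin).exists
  have hε : 0 < ε := hε
  set x := w + Complex.I * ε * e with hx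
  set y := w - Complex.I * ε * e with hy
  have hseg : ∀ i, ∀ t ∈ uIcc (a i) (b i), (i = j → t ≠ τ) → σ i t ∉ segment ℝ x y := by
    intro i t ht hit
    by_cases h : i = j ∧ t ∈ Metric.ball τ δ
    · obtain ⟨rfl, h⟩ := h
      exact fun hmem => hδt t h (hit rfl) (hsegre ε _ hmem)
    · refine hεfar i t ⟨ht, ?_⟩
      split_ifs with hij
      · exact fun h' => h ⟨hij, h'⟩
      · simp
  have hIe : Complex.I * ε * e ≠ 0 := by simp [hε.ne', hne]
  have hnot : ∀ z ∈ segment ℝ x y, z ≠ w → z ∈ Kᶜ := by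
    intro z hz hzw hzK
    obtain ⟨i, t, ht, rfl⟩ := mem_iUnion.1 hzK
    refine hseg i t ht ?_ hz
    rintro rfl rfl
    exact hzw rfl
  have hxK : x ∈ Kᶜ := hnot x (left_mem_segment ℝ x y) fun h => hIe (by
    rw [hx] at h; linear_combination h)
  have hyK : y ∈ Kᶜ := hnot y (right_mem_segment ℝ x y) fun h => hIe (by
    rw [hy] at h; linear_combination -h)
  have hIxy : I x - I y = 0 := sub_eq_zero.2 (hconst x hxK y hyK)
  rw [hI] at hIxy
  simp only at hIxy
  rw [← Finset.sum_sub_distrib, ← Finset.add_sum_erase _ _ (Finset.mem_univ j)] at hIxy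
  have hrest : ∑ i ∈ Finset.univ.erase j, ((∫ t in (a i)..(b i), σ' i t / (σ i t - x)) -
      ∫ t in (a i)..(b i), σ' i t / (σ i t - y)) = ∑ i ∈ Finset.univ.erase j,
      (Complex.log ((σ i (b i) - x) / (σ i (b i) - y)) -
        Complex.log ((σ i (a i) - x) / (σ i (a i) - y))) :=
    Finset.sum_congr rfl fun i hi => integral_div_sub_sub_of_disjoint_segment (hd i) (hc i)
      fun t ht => hseg i t ht fun h => absurd h (Finset.ne_of_mem_erase hi)
  have hall := hcyc fun z => Complex.log ((z - x) / (z - y))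
  rw [← Finset.add_sum_erase _ _ (Finset.mem_univ j)] at hall
  rw [hrest] at hIxy
  have hpi : (2 * Real.pi * Complex.I : ℂ) ≠ 0 := Complex.two_pi_I_ne_zero
  rcases lt_trichotomy (a j) (b j) with hab | hab | hab
  · rw [min_eq_left hab.le, max_eq_right hab.le] at hτ
    have huI : uIcc (a j) (b j) = Icc (a j) (b j) := uIcc_of_le hab.le
    rw [integral_div_sub_sub_of_crossing hτ.1 hτ.2 hε (fun t ht => hd j t (huI ▸ ht))
      (huI ▸ hc j) hne hlt hgt hx hy
      (fun t ht htτ => hseg j t (huI ▸ ht) fun _ => htτ)] at hIxy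
    exact hpi (by linear_combination hIxy - hall)
  · rw [hab, min_self, max_self] at hτ
    exact lt_asymm hτ.1 hτ.2
  · rw [min_eq_right hab.le, max_eq_left hab.le] at hτ
    have huI : uIcc (a j) (b j) = Icc (b j) (a j) := uIcc_of_ge hab.le
    have := integral_div_sub_sub_of_crossing hτ.1 hτ.2 hε (fun t ht => hd j t (huI ▸ ht))
      (huI ▸ hc j) hne hlt hgt hx hy
      (fun t ht htτ => hseg j t (huI ▸ ht) fun _ => htτ)
    rw [intervalIntegral.integral_symm (b j), intervalIntegral.integral_symm (b j)] at hIxy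
    exact hpi (by linear_combination hall - this - hIxy)

theorem false_of_simple_point_of_re_eq_zero {F : ℂ → ℂ} {R : ℝ}
    (hF : AnalyticOnNhd ℂ F (Metric.ball 0 R))
    (hnc : ¬ ∃ a : ℝ, ∀ z ∈ Metric.ball (0 : ℂ) R, (F z).re = a)
    {ι : Type*} [Fintype ι] {σ σ' : ι → ℝ → ℂ} {a b : ι → ℝ}
    (hd : ∀ i, ∀ t ∈ uIcc (a i) (b i), HasDerivAt (σ i) (σ' i t) t)
    (hc : ∀ i, ContinuousOn (σ' i) (uIcc (a i) (b i)))
    (hcyc : ∀ g : ℂ → ℂ, ∑ i, (g (σ i (b i)) - g (σ i (a i))) = 0)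
    (hin : ∀ i, ∀ t ∈ uIcc (a i) (b i),
      σ i t ∈ nodalSet (fun z => (F z).re) (Metric.ball 0 R))
    {j : ι} {τ : ℝ} (hτ : τ ∈ Ioo (min (a j) (b j)) (max (a j) (b j))) (hne : σ' j τ ≠ 0)
    (hsimple : ∀ i, ∀ t ∈ uIcc (a i) (b i), σ i t = σ j τ → i = j ∧ t = τ) : False := by
  refine false_of_simple_point hd hc hcyc ?_ hτ hne hsimple
  refine isPreconnected_compl_of_re_eq_zero hF hnc ?_ ?_ ?_
  · exact isCompact_iUnion fun i => isCompact_uIcc.image_of_continuousOn fun t ht =>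
      (hd i t ht).continuousAt.continuousWithinAt
  · refine iUnion_subset fun i => ?_
    rintro _ ⟨t, ht, rfl⟩
    exact (hin i t ht).1
  · intro z hz
    obtain ⟨i, t, ht, rfl⟩ := mem_iUnion.1 hz
    exact (hin i t ht).2

/-! ### Injectivity of nodal curves -/

theorem HasStrictDerivAt.eventually_injective {𝕜 E : Type*} [NontriviallyNormedField 𝕜]
    [NormedAddCommGroup E] [NormedSpace 𝕜 E] {f : 𝕜 → E} {e : E} {t : 𝕜}
    (h : HasStrictDerivAt f e t) (he : e ≠ 0) :
    ∀ᶠ q : 𝕜 × 𝕜 in 𝓝 (t, t), f q.1 = f q.2 → q.1 = q.2 := by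
  have h1 := (HasStrictFDerivAt.isLittleO h).def
    (c := ‖e‖ / 2) (by positivity)
  filter_upwards [h1] with q hq hfq
  by_contra hne
  have hpos : 0 < ‖q.1 - q.2‖ := norm_pos_iff.2 (sub_ne_zero.2 hne)
  simp only [hfq, sub_self, zero_sub, norm_neg, ContinuousLinearMap.toSpanSingleton_apply,
    norm_smul] at hq
  nlinarith [norm_pos_iff.2 he]

theorem IsRegularAnalyticCurveIn.hasDerivAt {u : ℂ → ℝ} {D : Set ℂ} {γ : ℝ → ℂ}
    (h : IsRegularAnalyticCurveIn u D γ) (t : ℝ) : HasDerivAt γ (deriv γ t) t :=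
  (h.analytic t (mem_univ t)).differentiableAt.hasDerivAt

theorem IsRegularAnalyticCurveIn.continuous {u : ℂ → ℝ} {D : Set ℂ} {γ : ℝ → ℂ}
    (h : IsRegularAnalyticCurveIn u D γ) : Continuous γ :=
  continuous_iff_continuousAt.2 fun t => (h.hasDerivAt t).continuousAt

theorem IsRegularAnalyticCurveIn.continuous_deriv {u : ℂ → ℝ} {D : Set ℂ} {γ : ℝ → ℂ}
    (h : IsRegularAnalyticCurveIn u D γ) : Continuous (deriv γ) :=
  continuous_iff_continuousAt.2 fun t => (h.analytic t (mem_univ t)).deriv.continuousAt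

theorem IsRegularAnalyticCurveIn.mem {u : ℂ → ℝ} {D : Set ℂ} {γ : ℝ → ℂ}
    (h : IsRegularAnalyticCurveIn u D γ) (t : ℝ) : γ t ∈ nodalSet u D :=
  h.subset_nodalSet (mem_range_self t)

/-- A regular analytic curve in the zero set of a nonconstant harmonic function on a disc has no
self-intersections. -/
theorem IsRegularAnalyticCurveIn.injective {F : ℂ → ℂ} {R : ℝ}
    (hF : AnalyticOnNhd ℂ F (Metric.ball 0 R))
    (hnc : ¬ ∃ a : ℝ, ∀ z ∈ Metric.ball (0 : ℂ) R, (F z).re = a) {γ : ℝ → ℂ}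
    (hγ : IsRegularAnalyticCurveIn (fun z => (F z).re) (Metric.ball 0 R) γ) :
    Function.Injective γ := by
  have key : ∀ x y, x < y → γ x ≠ γ y := by
    intro x y hxy heq
    set T : Set (ℝ × ℝ) := (Icc x y ×ˢ Icc x y) ∩ {q | q.1 ≤ q.2 ∧ γ q.1 = γ q.2} with hT
    set S : Set (ℝ × ℝ) := (Icc x y ×ˢ Icc x y) ∩ {q | q.1 < q.2 ∧ γ q.1 = γ q.2} with hS
    have hTc : IsClosed T := by
      refine (isClosed_Icc.prod isClosed_Icc).inter
        ((isClosed_le continuous_fst continuous_snd).inter (isClosed_eq ?_ ?_))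
      · exact hγ.continuous.comp continuous_fst
      · exact hγ.continuous.comp continuous_snd
    have hST : S ⊆ T := fun q hq => ⟨hq.1, hq.2.1.le, hq.2.2⟩
    -- The strict inequality survives in the limit because a regular curve is locally injective, so
    -- pairs of equal value cannot merge on the diagonal.
    have hSc : IsClosed S := by
      refine isClosed_iff_frequently.2 fun q hq => ?_
      have hqT : q ∈ T := isClosed_iff_frequently.1 hTc q (hq.mono fun z hz => hST hz)
      refine ⟨hqT.1, lt_of_le_of_ne hqT.2.1 fun h => ?_, hqT.2.2⟩
      obtain ⟨s, t⟩ := q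
      simp only at h
      subst h
      have h1 := (hγ.analytic s (mem_univ s)).hasStrictDerivAt.eventually_injective (hγ.regular s)
      obtain ⟨z, hz1, hz2⟩ := (hq.and_eventually h1).exists
      exact hz1.2.1.ne (hz2 hz1.2.2)
    have hScomp : IsCompact S := (isCompact_Icc.prod isCompact_Icc).of_isClosed_subset hSc
      inter_subset_left
    have hSne : S.Nonempty :=
      ⟨(x, y), ⟨⟨le_rfl, hxy.le⟩, ⟨hxy.le, le_rfl⟩⟩, hxy, heq⟩
    -- On a loop of least parameter length the midpoint is visited only once: another visit would
    -- cut out a loop of at most half that length.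
    obtain ⟨⟨s, t⟩, hst, hmin⟩ := hScomp.exists_isMinOn hSne
      (f := fun q : ℝ × ℝ => q.2 - q.1) (by fun_prop)
    have hst' : s < t := hst.2.1
    have huI : uIcc s t = Icc s t := uIcc_of_le hst'.le
    have hmin' : ∀ a b, a ∈ Icc s t → b ∈ Icc s t → a < b → γ a = γ b → t - s ≤ b - a :=
      fun a b ha hb hab hh => hmin (show (a, b) ∈ S from
        ⟨⟨⟨hst.1.1.1.trans ha.1, ha.2.trans hst.1.2.2⟩, ⟨hst.1.1.1.trans hb.1,
          hb.2.trans hst.1.2.2⟩⟩, hab, hh⟩)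
    refine false_of_simple_point_of_re_eq_zero hF hnc (ι := Unit) (σ := fun _ => γ)
      (σ' := fun _ => deriv γ) (a := fun _ => s) (b := fun _ => t) (j := ()) (τ := (s + t) / 2)
      (fun _ t _ => hγ.hasDerivAt t) (fun _ => hγ.continuous_deriv.continuousOn)
      (fun g => ?_) (fun _ t _ => hγ.mem t) ?_ (hγ.regular _) ?_
    · simp [show γ s = γ t from hst.2.2]
    · rw [min_eq_left hst'.le, max_eq_right hst'.le]
      constructor <;> linarith
    · intro _ r hr hr2
      rw [huI] at hr
      refine ⟨rfl, ?_⟩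
      rcases lt_trichotomy r ((s + t) / 2) with h | h | h
      · have := hmin' r _ hr ⟨by linarith, by linarith⟩ h hr2
        linarith [hr.1]
      · exact h
      · have := hmin' _ r ⟨by linarith, by linarith⟩ hr h hr2.symm
        linarith [hr.2]
  intro x y h
  rcases lt_trichotomy x y with h1 | h1 | h1
  · exact absurd h (key x y h1)
  · exact h1
  · exact absurd h.symm (key y x h1)

/-! ### Tangents, transversal branches and critical zeros -/

/-- Every line of accumulation of `S` at `q` has direction `e`. -/
def IsTangentAt (S : Set ℂ) (q e : ℂ) : Prop :=
  (fun z => ((starRingEnd ℂ) e * (z - q)).im) =o[𝓝[S] q] fun z => z - q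

/-- Near `t₀` this is differentiability with `e ≠ 0`; the rest of the compact arc misses `σ t₀` by
`huniq`, hence misses a neighbourhood of it. -/
theorem isTangentAt_image {σ : ℝ → ℂ} {J : Set ℝ} {t₀ : ℝ} {e : ℂ} (hJ : IsCompact J)
    (hσ : ContinuousOn σ J) (hd : HasDerivAt σ e t₀) (he : e ≠ 0)
    (huniq : ∀ t ∈ J, σ t = σ t₀ → t = t₀) : IsTangentAt (σ '' J) (σ t₀) e := by
  have h1 : (fun t => ((starRingEnd ℂ) e * (σ t - σ t₀)).im) =o[𝓝 t₀] fun t => t - t₀ := by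
    have h2 : HasDerivAt (fun t => ((starRingEnd ℂ) e * (σ t - σ t₀)).im) 0 t₀ := by
      have h3 := Complex.imCLM.hasFDerivAt.comp_hasDerivAt t₀
        ((hd.sub_const (σ t₀)).const_mul ((starRingEnd ℂ) e))
      have h4 : ((starRingEnd ℂ) e * e).im = 0 := by simp [Complex.mul_im]; ring
      simpa [Function.comp_def, h4] using h3
    simpa using hasDerivAt_iff_isLittleO.1 h2
  have h2 : (fun t => ((starRingEnd ℂ) e * (σ t - σ t₀)).im) =o[𝓝 t₀] fun t => σ t - σ t₀ :=
    h1.trans_isBigO ((HasDerivAtFilter.isTheta_sub hd he).2.comp_tendsto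
      (tendsto_id.prodMk tendsto_const_pure))
  refine Asymptotics.isLittleO_iff.2 fun c hc => ?_
  obtain ⟨δ, hδ, hδt⟩ := Metric.eventually_nhds_iff_ball.1 (Asymptotics.isLittleO_iff.1 h2 hc)
  have hcpt : IsCompact (σ '' (J \ Metric.ball t₀ δ)) :=
    (hJ.diff Metric.isOpen_ball).image_of_continuousOn (hσ.mono sdiff_subset)
  have hq : σ t₀ ∈ (σ '' (J \ Metric.ball t₀ δ))ᶜ := by
    rintro ⟨t, ht, htq⟩
    exact ht.2 (huniq t ht.1 htq ▸ Metric.mem_ball_self hδ)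
  filter_upwards [nhdsWithin_le_nhds (hcpt.isClosed.isOpen_compl.mem_nhds hq), self_mem_nhdsWithin]
    with z hz1 hz2
  obtain ⟨t, ht, rfl⟩ := hz2
  by_cases h : t ∈ Metric.ball t₀ δ
  · exact hδt t h
  · exact absurd ⟨t, ⟨ht, h⟩, rfl⟩ hz1

/-- With `ζ = z - q` and `d = Im (ē₁ e₂)` one has `d ζ = e₂ Im (ē₁ ζ) - e₁ Im (ē₂ ζ)`. At common
points both terms on the right are `o(ζ)`, which forces `d = 0`. -/
theorem IsTangentAt.parallel {S T : Set ℂ} {q e₁ e₂ : ℂ} (h₁ : IsTangentAt S q e₁)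
    (h₂ : IsTangentAt T q e₂) (hfr : ∃ᶠ z in 𝓝[≠] q, z ∈ S ∩ T) :
    ((starRingEnd ℂ) e₁ * e₂).im = 0 := by
  by_contra hne
  have hA := (h₁.mono (nhdsWithin_mono q inter_subset_left : 𝓝[S ∩ T] q ≤ _))
  have hB := (h₂.mono (nhdsWithin_mono q inter_subset_right : 𝓝[S ∩ T] q ≤ _))
  set d := ((starRingEnd ℂ) e₁ * e₂).im with hd
  set c : ℝ := |d| / (2 * (‖e₁‖ + ‖e₂‖ + 1)) with hc
  have hc0 : 0 < c := by positivity
  have h3 := (Asymptotics.isLittleO_iff.1 hA hc0).and (Asymptotics.isLittleO_iff.1 hB hc0)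
  have hfr' : ∃ᶠ z in 𝓝[S ∩ T] q, z ≠ q := by
    rw [frequently_nhdsWithin_iff] at hfr ⊢
    exact hfr.mono fun z hz => ⟨hz.2, hz.1⟩
  obtain ⟨z, hz, hz1, hz2⟩ := (hfr'.and_eventually h3).exists
  set ζ := z - q with hζ
  have hpos : 0 < ‖ζ‖ := norm_pos_iff.2 (sub_ne_zero.2 hz)
  have hid : (d : ℂ) * ζ = e₂ * (((starRingEnd ℂ) e₁ * ζ).im : ℂ)
      - e₁ * (((starRingEnd ℂ) e₂ * ζ).im : ℂ) := by
    apply Complex.ext <;> simp [hd] <;> ring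
  have h4 : |d| * ‖ζ‖ ≤ ‖e₂‖ * (c * ‖ζ‖) + ‖e₁‖ * (c * ‖ζ‖) := by
    calc |d| * ‖ζ‖ = ‖(d : ℂ) * ζ‖ := by simp
      _ ≤ _ := by
        rw [hid]
        refine (norm_sub_le _ _).trans ?_
        rw [norm_mul, norm_mul, Complex.norm_real, Complex.norm_real]
        gcongr
  have h5 : c * (2 * (‖e₁‖ + ‖e₂‖ + 1)) = |d| := by rw [hc]; field_simp
  have h6 : 0 < c * ‖ζ‖ := mul_pos hc0 hpos
  nlinarith [norm_nonneg e₁, norm_nonneg e₂]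

/-- A holomorphic function is locally a constant plus the `m`-th power of a local coordinate. -/
theorem exists_local_coordinate {F : ℂ → ℂ} {q : ℂ} {m : ℕ} (hF : AnalyticAt ℂ F q) (hm : m ≠ 0)
    (hord : analyticOrderAt (fun z => F z - F q) q = m) :
    ∃ χ : ℂ → ℂ, AnalyticAt ℂ χ q ∧ χ q = 0 ∧ deriv χ q ≠ 0 ∧
      ∀ᶠ z in 𝓝 q, F z = F q + χ z ^ m := by
  obtain ⟨g, hg, hgq, hFg⟩ :=
    ((hF.sub analyticAt_const).analyticOrderAt_eq_natCast (n := m)).1 hord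
  obtain ⟨c, hc⟩ := IsAlgClosed.exists_pow_nat_eq (g q) (Nat.pos_of_ne_zero hm)
  have hc0 : c ≠ 0 := by rintro rfl; exact hgq (by rw [← hc, zero_pow hm])
  have hm' : (m : ℂ) ≠ 0 := by exact_mod_cast hm
  have hlog : AnalyticAt ℂ (fun z => Complex.log (g z / g q)) q := by
    refine (hg.div analyticAt_const hgq).clog ?_
    simp [hgq]
  set k : ℂ → ℂ := fun z => c * Complex.exp (Complex.log (g z / g q) / m) with hk
  have hka : AnalyticAt ℂ k q := analyticAt_const.mul (hlog.div analyticAt_const hm').cexp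
  have hkq : k q = c := by simp [hk, hgq]
  have hχ : AnalyticAt ℂ (fun z => (z - q) * k z) q :=
    (analyticAt_id.sub analyticAt_const).mul hka
  refine ⟨fun z => (z - q) * k z, hχ, by simp, ?_, ?_⟩
  · have : HasDerivAt (fun z => (z - q) * k z) (1 * k q + (q - q) * deriv k q) q :=
      ((hasDerivAt_id q).sub_const q).mul hka.differentiableAt.hasDerivAt
    rw [this.deriv, hkq]
    simpa using hc0
  · filter_upwards [hFg, hg.continuousAt.eventually_ne hgq] with z hz hgz
    have h1 : k z ^ m = g z := by
      rw [hk, mul_pow, hc, ← Complex.exp_nat_mul, mul_div_cancel₀ _ hm',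
        Complex.exp_log (div_ne_zero hgz hgq), mul_div_cancel₀ _ hgq]
    rw [mul_pow, h1, ← smul_eq_mul, ← hz, Pi.sub_apply]
    ring

/-- Two neighbouring rays of `Re ωᵐ = 0` form the angle `π / m`, which is less than `π` for `m ≥ 2`;
a single line through the origin cannot contain both. -/
theorem exists_pow_re_eq_zero_and_im_ne_zero {m : ℕ} (hm : 2 ≤ m) {a : ℂ} (ha : a ≠ 0) :
    ∃ ω : ℂ, ω ≠ 0 ∧ (ω ^ m).re = 0 ∧ (a * ω).im ≠ 0 := by
  have hm0 : (m : ℂ) ≠ 0 := by exact_mod_cast (by omega : m ≠ 0)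
  set ω₁ := Complex.exp (Real.pi / 2 * Complex.I / m) with h₁
  set ζ := Complex.exp ((Real.pi / m : ℝ) * Complex.I) with hζ
  have hω₁ : ω₁ ^ m = Complex.I := by
    rw [h₁, ← Complex.exp_nat_mul, mul_div_cancel₀ _ hm0, Complex.exp_pi_div_two_mul_I]
  have hζm : ζ ^ m = -1 := by
    rw [hζ, ← Complex.exp_nat_mul]
    push_cast
    rw [← mul_assoc, mul_div_cancel₀ _ hm0, Complex.exp_pi_mul_I]
  by_cases h : (a * ω₁).im = 0
  · refine ⟨ω₁ * ζ, mul_ne_zero (Complex.exp_ne_zero _) (Complex.exp_ne_zero _), ?_, ?_⟩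
    · rw [mul_pow, hω₁, hζm]; simp
    · have hre : (a * ω₁).re ≠ 0 := fun h' =>
        mul_ne_zero ha (Complex.exp_ne_zero _) (Complex.ext h' h)
      rw [← mul_assoc, Complex.mul_im, h, zero_mul, add_zero]
      refine mul_ne_zero hre ?_
      rw [hζ, Complex.exp_ofReal_mul_I_im]
      have hm2 : (2 : ℝ) ≤ m := by exact_mod_cast hm
      refine (Real.sin_pos_of_pos_of_lt_pi (by positivity) ?_).ne'
      exact div_lt_self Real.pi_pos (by linarith)
  · exact ⟨ω₁, Complex.exp_ne_zero _, by simp [hω₁], h⟩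

/-- At a critical zero, a branch of the zero set is transversal to any given direction. -/
theorem exists_transversal_branch {F : ℂ → ℂ} {R : ℝ}
    (hF : AnalyticOnNhd ℂ F (Metric.ball 0 R))
    (hnc : ¬ ∃ a : ℝ, ∀ z ∈ Metric.ball (0 : ℂ) R, (F z).re = a) {q e : ℂ}
    (hq : q ∈ nodalSet (fun z => (F z).re) (Metric.ball 0 R)) (hcrit : deriv F q = 0)
    (he : e ≠ 0) :
    ∃ β : ℝ → ℂ, AnalyticAt ℝ β 0 ∧ β 0 = q ∧ ((starRingEnd ℂ) e * deriv β 0).im ≠ 0 ∧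
      ∀ᶠ x in 𝓝 0, β x ∈ nodalSet (fun z => (F z).re) (Metric.ball 0 R) := by
  have hFq := hF q hq.1
  have hG : AnalyticAt ℂ (fun z => F z - F q) q := hFq.sub analyticAt_const
  have htop : analyticOrderAt (fun z => F z - F q) q ≠ ⊤ := by
    rw [Ne, analyticOrderAt_eq_top]
    intro h
    exact not_eventually_eq_const_of_re_not_const hF hnc hq.1 (F q)
      (h.mono fun z hz => sub_eq_zero.1 hz)
  obtain ⟨m, hm⟩ := ENat.ne_top_iff_exists.1 htop
  have hm0 : m ≠ 0 := by
    rintro rfl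
    rw [Nat.cast_zero] at hm
    exact (hG.analyticOrderAt_eq_zero.1 hm.symm) (sub_self _)
  obtain ⟨χ, hχ, hχq, hχ', hFχ⟩ := exists_local_coordinate hFq hm0 hm.symm
  have hm2 : 2 ≤ m := by
    by_contra hlt
    have hm1 : m = 1 := by omega
    subst hm1
    have h1 : deriv F q = deriv (fun z => F q + χ z ^ 1) q := Filter.EventuallyEq.deriv_eq hFχ
    rw [hcrit] at h1
    simp only [pow_one, deriv_const_add] at h1
    exact hχ' h1.symm
  have ha : (starRingEnd ℂ) e * (deriv χ q)⁻¹ ≠ 0 :=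
    mul_ne_zero ((map_ne_zero _).2 he) (inv_ne_zero hχ')
  -- As `F q` is imaginary, the zero set in the coordinate `χ` is `Re χᵐ = 0`, a union of lines. The
  -- branch is the preimage of the line `ℝ ω`.
  obtain ⟨ω, hω0, hωm, hωim⟩ := exists_pow_re_eq_zero_and_im_ne_zero hm2 ha
  set g := hχ.hasStrictDerivAt.localInverse _ _ _ hχ' with hg
  have hga : AnalyticAt ℂ g 0 := by
    have := hχ.analyticAt_localInverse hχ'
    rwa [hχq] at this
  have hgd : HasDerivAt g (deriv χ q)⁻¹ 0 := by
    have := (hχ.hasStrictDerivAt.to_localInverse hχ').hasDerivAt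
    rwa [hχq] at this
  have hg0 : g 0 = q := by
    have := (hχ.hasStrictDerivAt.eventually_left_inverse hχ').self_of_nhds
    rwa [hχq] at this
  have hgr : ∀ᶠ w in 𝓝 0, χ (g w) = w := by
    have := hχ.hasStrictDerivAt.eventually_right_inverse hχ'
    rwa [hχq] at this
  have hlin : AnalyticAt ℝ (fun x : ℝ => (x : ℂ) * ω) 0 :=
    (Complex.ofRealCLM.analyticAt 0).mul analyticAt_const
  have hlin0 : ((0 : ℝ) : ℂ) * ω = 0 := by simp
  have hlint : Tendsto (fun x : ℝ => (x : ℂ) * ω) (𝓝 0) (𝓝 0) := by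
    have := hlin.continuousAt.tendsto
    rwa [hlin0] at this
  have hβ : AnalyticAt ℝ (fun x : ℝ => g (x * ω)) 0 := by
    refine AnalyticAt.fun_comp (g := g) ?_ hlin
    rw [hlin0]
    exact hga.restrictScalars
  have hβd : HasDerivAt (fun x : ℝ => g (x * ω)) ((deriv χ q)⁻¹ * ω) 0 := by
    have h1 : HasDerivAt (fun x : ℝ => (x : ℂ) * ω) (1 * ω) 0 :=
      (Complex.ofRealCLM.hasDerivAt (x := (0 : ℝ))).mul_const ω
    rw [one_mul] at h1
    have h2 : HasDerivAt g (deriv χ q)⁻¹ (((0 : ℝ) : ℂ) * ω) := by rwa [hlin0]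
    exact h2.comp (0 : ℝ) h1
  refine ⟨fun x => g (x * ω), hβ, by simp [hg0], ?_, ?_⟩
  · rw [hβd.deriv, ← mul_assoc]
    exact hωim
  · have hgt : Tendsto (fun x : ℝ => g (x * ω)) (𝓝 0) (𝓝 q) := by
      have := hβ.continuousAt.tendsto
      simpa [hg0] using this
    filter_upwards [hgt.eventually hFχ, hlint.eventually hgr,
      hgt.eventually (Metric.isOpen_ball.mem_nhds hq.1)] with x hx1 hx2 hx3
    refine ⟨hx3, ?_⟩
    have h0 : (F q).re = 0 := hq.2
    show (F (g (x * ω))).re = 0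
    rw [hx1, hx2, mul_pow, Complex.add_re, h0, zero_add, ← Complex.ofReal_pow,
      Complex.re_ofReal_mul, hωm, mul_zero]

theorem conj_mul_im_eq_zero_trans {a b c : ℂ} (hc : c ≠ 0) (h₁ : ((starRingEnd ℂ) a * c).im = 0)
    (h₂ : ((starRingEnd ℂ) b * c).im = 0) : ((starRingEnd ℂ) a * b).im = 0 := by
  simp only [Complex.mul_im, Complex.conj_re, Complex.conj_im] at *
  by_contra hne
  refine hc (Complex.ext ?_ ?_)
  · refine (mul_eq_zero.1 (?_ : (a.re * b.im + -a.im * b.re) * c.re = 0)).resolve_left hne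
    linear_combination (-a.re) * h₂ + b.re * h₁
  · refine (mul_eq_zero.1 (?_ : (a.re * b.im + -a.im * b.re) * c.im = 0)).resolve_left hne
    linear_combination b.im * h₁ - a.im * h₂

theorem uIoo_mem_neBot {a b : ℝ} (h : a ≠ b) :
    (𝓝[Ioo (min a b) (max a b)] a).NeBot := by
  rw [← mem_closure_iff_nhdsWithin_neBot, closure_Ioo (min_lt_max.2 h).ne]
  exact ⟨min_le_left _ _, le_max_left _ _⟩

theorem frequently_image_nhdsNE {σ : ℝ → ℂ} {a b : ℝ} (hab : a ≠ b) (hσ : ContinuousAt σ a)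
    (hne : ∀ t ∈ Ioo (min a b) (max a b), σ t ≠ σ a) {P : ℂ → Prop}
    (hP : ∀ t ∈ Ioo (min a b) (max a b), P (σ t)) : ∃ᶠ z in 𝓝[≠] (σ a), P z := by
  have := uIoo_mem_neBot hab
  have h1 : Tendsto σ (𝓝[Ioo (min a b) (max a b)] a) (𝓝[≠] (σ a)) :=
    tendsto_nhdsWithin_iff.2 ⟨hσ.tendsto.mono_left nhdsWithin_le_nhds,
      eventually_nhdsWithin_of_forall hne⟩
  exact h1.frequently (eventually_nhdsWithin_of_forall hP).frequently

/-- If every point of the zero set of a nonconstant harmonic function on a disc is joined to `p`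
by a regular analytic curve in the zero set, then `p` is the only possible critical zero. -/
theorem deriv_ne_zero_of_nodal {F : ℂ → ℂ} {R : ℝ} {p : ℂ}
    (hF : AnalyticOnNhd ℂ F (Metric.ball 0 R))
    (hnc : ¬ ∃ a : ℝ, ∀ z ∈ Metric.ball (0 : ℂ) R, (F z).re = a)
    (hcov : ∀ z ∈ nodalSet (fun z => (F z).re) (Metric.ball 0 R), ∃ γ : ℝ → ℂ,
      IsRegularAnalyticCurveIn (fun z => (F z).re) (Metric.ball 0 R) γ ∧
        z ∈ range γ ∧ p ∈ range γ) {q : ℂ}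
    (hq : q ∈ nodalSet (fun z => (F z).re) (Metric.ball 0 R)) (hqp : q ≠ p) :
    deriv F q ≠ 0 := by
  intro hcrit
  obtain ⟨γ, hγ, ⟨tq, htq⟩, ⟨tp, htp⟩⟩ := hcov q hq
  have hγi := hγ.injective hF hnc
  obtain ⟨β, hβa, hβ0, hβim, hβn⟩ :=
    exists_transversal_branch hF hnc hq hcrit (hγ.regular tq)
  have hβ' : deriv β 0 ≠ 0 := fun h => hβim (by simp [h])
  obtain ⟨ε, hε, hβε⟩ : ∃ ε > 0, ∀ x ∈ Icc 0 ε, AnalyticAt ℝ β x ∧ deriv β x ≠ 0 ∧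
      β x ∈ nodalSet (fun z => (F z).re) (Metric.ball 0 R) ∧
      ∀ y ∈ Icc 0 ε, β x = β y → x = y := by
    have h1 : ∀ᶠ x in 𝓝 (0 : ℝ), AnalyticAt ℝ β x ∧ deriv β x ≠ 0 ∧
        β x ∈ nodalSet (fun z => (F z).re) (Metric.ball 0 R) :=
      hβa.eventually_analyticAt.and ((hβa.deriv.continuousAt.eventually_ne hβ').and hβn)
    obtain ⟨r, hr, h1⟩ := Metric.eventually_nhds_iff_ball.1 h1
    obtain ⟨s, hs, h2⟩ := Metric.eventually_nhds_iff_ball.1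
      (hβa.hasStrictDerivAt.eventually_injective hβ')
    have hmem : ∀ x ∈ Icc 0 (min r s / 2), x ∈ Metric.ball 0 r ∧ x ∈ Metric.ball 0 s := by
      intro x hx
      simp only [Metric.mem_ball, dist_zero_right, Real.norm_eq_abs, abs_of_nonneg hx.1]
      have := lt_min hr hs
      constructor
      · linarith [hx.2, min_le_left r s]
      · linarith [hx.2, min_le_right r s]
    refine ⟨min r s / 2, half_pos (lt_min hr hs), fun x hx =>
      ⟨(h1 x (hmem x hx).1).1, (h1 x (hmem x hx).1).2.1, (h1 x (hmem x hx).1).2.2, ?_⟩⟩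
    intro y hy hxy
    refine h2 (x, y) ?_ hxy
    rw [← ball_prod_same]
    exact ⟨(hmem x hx).2, (hmem y hy).2⟩
  have hε' : (0 : ℝ) ≤ ε := le_of_lt hε
  have huε : uIcc 0 ε = Icc 0 ε := uIcc_of_le hε'
  obtain ⟨η, hη, ⟨t₂, ht₂⟩, ⟨sp, hsp⟩⟩ := hcov (β ε) (hβε ε ⟨hε', le_rfl⟩).2.2.1
  have hηi := hη.injective hF hnc
  have hβd : ∀ x ∈ uIcc 0 ε, HasDerivAt β (deriv β x) x := fun x hx =>
    (hβε x (huε ▸ hx)).1.differentiableAt.hasDerivAt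
  have hβc : ContinuousOn β (uIcc 0 ε) := fun x hx => (hβd x hx).continuousAt.continuousWithinAt
  set A := γ '' uIcc tp tq with hA
  set B := β '' uIcc 0 ε with hB
  set C := η '' uIcc t₂ sp with hC
  -- The cycle runs from `p` to `q` along `γ`, then to `β ε` along the new branch, then back to `p`
  -- along `η`. None of its regular interior points may be visited exactly once.
  have cycle : ∀ (j : Fin 3) (τ : ℝ),
      τ ∈ Ioo (min ((![tp, 0, t₂] : Fin 3 → ℝ) j) ((![tq, ε, sp] : Fin 3 → ℝ) j))
        (max ((![tp, 0, t₂] : Fin 3 → ℝ) j) ((![tq, ε, sp] : Fin 3 → ℝ) j)) →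
      (![deriv γ, deriv β, deriv η] : Fin 3 → ℝ → ℂ) j τ ≠ 0 →
      (∀ i, ∀ t ∈ uIcc ((![tp, 0, t₂] : Fin 3 → ℝ) i) ((![tq, ε, sp] : Fin 3 → ℝ) i),
        (![γ, β, η] : Fin 3 → ℝ → ℂ) i t = (![γ, β, η] : Fin 3 → ℝ → ℂ) j τ →
          i = j ∧ t = τ) → False := by
    intro j τ hτ hne hs
    refine false_of_simple_point_of_re_eq_zero hF hnc ?_ ?_ ?_ ?_ hτ hne hs
    · rw [Fin.forall_fin_succ, Fin.forall_fin_succ, Fin.forall_fin_one]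
      exact ⟨fun t _ => hγ.hasDerivAt t, hβd, fun t _ => hη.hasDerivAt t⟩
    · rw [Fin.forall_fin_succ, Fin.forall_fin_succ, Fin.forall_fin_one]
      exact ⟨hγ.continuous_deriv.continuousOn,
        fun x hx => (hβε x (huε ▸ hx)).1.deriv.continuousAt.continuousWithinAt,
        hη.continuous_deriv.continuousOn⟩
    · intro g
      simp [Fin.sum_univ_succ, htq, htp, hβ0, ht₂, hsp]
      ring
    · rw [Fin.forall_fin_succ, Fin.forall_fin_succ, Fin.forall_fin_one]
      exact ⟨fun t _ => hγ.mem t, fun x hx => (hβε x (huε ▸ hx)).2.2.1, fun t _ => hη.mem t⟩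
  have htpq : tq ≠ tp := fun h => hqp (by rw [← htq, ← htp, h])
  have hABC : ∀ τ ∈ Ioo (min tq tp) (max tq tp), γ τ ∈ A ∩ B ∨ γ τ ∈ A ∩ C := by
    intro τ hτ
    rw [min_comm, max_comm] at hτ
    have hτA : γ τ ∈ A := ⟨τ, ⟨hτ.1.le, hτ.2.le⟩, rfl⟩
    by_contra hcon
    push Not at hcon
    refine cycle 0 τ hτ (hγ.regular τ) ?_
    rw [Fin.forall_fin_succ, Fin.forall_fin_succ, Fin.forall_fin_one]
    refine ⟨fun t _ h => ⟨rfl, hγi h⟩, fun t ht h => ?_, fun t ht h => ?_⟩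
    · exact absurd ⟨hτA, t, ht, h⟩ hcon.1
    · exact absurd ⟨hτA, t, ht, h⟩ hcon.2
  have hBAC : ∀ τ ∈ Ioo (min 0 ε) (max 0 ε), β τ ∈ A ∩ B ∨ β τ ∈ B ∩ C := by
    intro τ hτ
    have hτu : τ ∈ uIcc 0 ε := ⟨hτ.1.le, hτ.2.le⟩
    have hτB : β τ ∈ B := ⟨τ, hτu, rfl⟩
    by_contra hcon
    push Not at hcon
    refine cycle 1 τ hτ (hβε τ (huε ▸ hτu)).2.1 ?_
    rw [Fin.forall_fin_succ, Fin.forall_fin_succ, Fin.forall_fin_one]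
    refine ⟨fun t ht h => ?_, fun t ht h => ⟨rfl, ?_⟩, fun t ht h => ?_⟩
    · exact absurd ⟨⟨t, ht, h⟩, hτB⟩ hcon.1
    · exact (hβε t (huε ▸ ht)).2.2.2 τ (huε ▸ hτu) h
    · exact absurd ⟨hτB, t, ht, h⟩ hcon.2
  have hTA : IsTangentAt A q (deriv γ tq) := by
    have := isTangentAt_image (isCompact_uIcc (a := tp) (b := tq)) hγ.continuous.continuousOn
      (hγ.hasDerivAt tq) (hγ.regular tq) fun t _ h => hγi h
    rwa [htq] at this
  have hTB : IsTangentAt B q (deriv β 0) := by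
    have := isTangentAt_image (isCompact_uIcc (a := 0) (b := ε)) hβc
      (hβd 0 left_mem_uIcc) hβ' fun t ht h =>
        (hβε t (huε ▸ ht)).2.2.2 0 (huε ▸ left_mem_uIcc) h
    rwa [hβ0] at this
  -- Transversality keeps `A` and `B` apart near `q`, so `C` must meet each of them arbitrarily
  -- close to `q`. The regular injective arc `C` has only one tangent at `q`, which cannot be
  -- parallel to both.
  have hnotAB : ¬ ∃ᶠ z in 𝓝[≠] q, z ∈ A ∩ B := fun h => hβim (hTA.parallel hTB h)
  have hfA : ∃ᶠ z in 𝓝[≠] q, z ∈ A ∩ C := by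
    have h1 := frequently_image_nhdsNE htpq hγ.continuous.continuousAt
      (fun t ht h => by
        have := hγi h
        subst this
        rcases min_lt_max.1 (ht.1.trans ht.2) |>.lt_or_gt with h' | h'
        · rw [min_eq_left h'.le] at ht; exact lt_irrefl _ ht.1
        · rw [max_eq_left h'.le] at ht; exact lt_irrefl _ ht.2)
      (P := fun z => z ∈ A ∩ B ∨ z ∈ A ∩ C) hABC
    rw [htq, frequently_or_distrib] at h1
    exact h1.resolve_left hnotAB
  have hfB : ∃ᶠ z in 𝓝[≠] q, z ∈ B ∩ C := by
    have h1 := frequently_image_nhdsNE (a := 0) (b := ε) (ne_of_lt hε)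
      (hβd 0 left_mem_uIcc).continuousAt
      (fun t ht h => by
        have ht' : t ∈ Icc 0 ε := huε ▸ ⟨ht.1.le, ht.2.le⟩
        have := (hβε t ht').2.2.2 0 ⟨le_rfl, hε'⟩ h
        subst this
        rw [min_eq_left hε'] at ht
        exact lt_irrefl _ ht.1)
      (P := fun z => z ∈ A ∩ B ∨ z ∈ B ∩ C) hBAC
    rw [hβ0, frequently_or_distrib] at h1
    exact h1.resolve_left hnotAB
  have hCc : IsClosed C :=
    (isCompact_uIcc.image_of_continuousOn hη.continuous.continuousOn).isClosed
  obtain ⟨s, hs, hsq⟩ : q ∈ C := isClosed_iff_frequently.1 hCc q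
    ((hfA.filter_mono nhdsWithin_le_nhds).mono fun z hz => hz.2)
  have hTC : IsTangentAt C q (deriv η s) := by
    have := isTangentAt_image (isCompact_uIcc (a := t₂) (b := sp)) hη.continuous.continuousOn
      (hη.hasDerivAt s) (hη.regular s) fun t _ h => hηi h
    rwa [hsq] at this
  exact hβim (conj_mul_im_eq_zero_trans (hη.regular s) (hTA.parallel hTC hfA)
    (hTB.parallel hTC hfB))

/-! ### Monotonicity of the imaginary part and the counting bound -/

theorem continuous_inverse_of_injOn_Icc {ψ : ℝ → ℝ} {s : ℝ} (hs : 0 ≤ s)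
    (hψ : ContinuousOn ψ (Icc 0 1)) (hinj : InjOn ψ (Icc 0 1)) (h0 : ψ 0 = 0) (h1 : ψ 1 = s) :
    ∃ g : ℝ → ℝ, Continuous g ∧ (∀ x ∈ Icc 0 s, g x ∈ Icc 0 1 ∧ ψ (g x) = x) := by
  have hmono : StrictMonoOn ψ (Icc 0 1) :=
    hψ.strictMonoOn_of_injOn_Icc zero_le_one (by rw [h0, h1]; exact hs) hinj
  have hmaps : MapsTo ψ (Icc 0 1) (Icc 0 s) := fun x hx =>
    ⟨h0 ▸ hmono.monotoneOn ⟨le_rfl, zero_le_one⟩ hx hx.1,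
      h1 ▸ hmono.monotoneOn hx ⟨zero_le_one, le_rfl⟩ hx.2⟩
  have hsurj : SurjOn ψ (Icc 0 1) (Icc 0 s) := by
    have := intermediate_value_Icc zero_le_one hψ
    rwa [h0, h1] at this
  set f : Icc (0 : ℝ) 1 → Icc (0 : ℝ) s := hmaps.restrict with hf
  have hfb : Function.Bijective f :=
    ⟨hmaps.restrict_inj.2 hinj, hmaps.restrict_surjective_iff.2 hsurj⟩
  have hfc : Continuous f := hψ.mapsToRestrict hmaps
  let h : Icc (0 : ℝ) 1 ≃ₜ Icc (0 : ℝ) s :=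
    Continuous.homeoOfEquivCompactToT2 (f := Equiv.ofBijective f hfb) hfc
  refine ⟨fun x => (h.symm (projIcc 0 s hs x) : ℝ), ?_, fun x hx => ⟨(h.symm _).2, ?_⟩⟩
  · exact continuous_subtype_val.comp (h.symm.continuous.comp continuous_projIcc)
  · have := congrArg Subtype.val (h.apply_symm_apply (projIcc 0 s hs x))
    rw [projIcc_of_mem hs hx] at this
    show ψ (h.symm (projIcc 0 s hs x)) = x
    rw [projIcc_of_mem hs hx]
    exact this

section Star

variable {F : ℂ → ℂ} {R : ℝ} {p : ℂ}

/-- Along the curve `F' γ'` is purely imaginary and vanishes at most at `p`, which injectivity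
confines to the parameter `a`. Two equal values of `Im F` would contradict Rolle's theorem. -/
theorem injOn_im_along_curve
    (hcrit : ∀ z ∈ nodalSet (fun z => (F z).re) (Metric.ball 0 R), z ≠ p → deriv F z ≠ 0)
    (hF : AnalyticOnNhd ℂ F (Metric.ball 0 R)) {γ : ℝ → ℂ}
    (hγ : IsRegularAnalyticCurveIn (fun z => (F z).re) (Metric.ball 0 R) γ)
    (hγi : Function.Injective γ) {a b : ℝ} (ha : γ a = p) (hab : b ≠ a) :
    InjOn (fun r : ℝ => (F (γ (a + r * (b - a)))).im) (Icc 0 1) := by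
  have hba : b - a ≠ 0 := sub_ne_zero.2 hab
  have hd : ∀ r : ℝ, HasDerivAt (fun r : ℝ => F (γ (a + r * (b - a))))
      ((b - a : ℝ) * (deriv F (γ (a + r * (b - a))) * deriv γ (a + r * (b - a)))) r := by
    intro r
    have h1 : HasDerivAt (fun r : ℝ => a + r * (b - a)) (b - a) r := by
      simpa using ((hasDerivAt_id r).mul_const (b - a)).const_add a
    have h2 := (hγ.hasDerivAt (a + r * (b - a))).scomp r h1
    have h3 : HasDerivAt F (deriv F (γ (a + r * (b - a)))) (γ (a + r * (b - a))) :=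
      (hF _ (hγ.mem _).1).differentiableAt.hasDerivAt
    have h4 : HasDerivAt (fun r : ℝ => F (γ (a + r * (b - a))))
        (deriv F (γ (a + r * (b - a))) * ((b - a) • deriv γ (a + r * (b - a)))) r := h3.comp r h2
    rw [Complex.real_smul] at h4
    rwa [mul_left_comm]
  have hre : ∀ r : ℝ, (((b - a : ℝ) : ℂ) * (deriv F (γ (a + r * (b - a))) *
      deriv γ (a + r * (b - a)))).re = 0 := by
    intro r
    have h1 := Complex.reCLM.hasFDerivAt.comp_hasDerivAt r (hd r)
    have h2 : (Complex.reCLM ∘ fun r : ℝ => F (γ (a + r * (b - a)))) = fun _ => 0 := by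
      funext r
      exact (hγ.mem _).2
    rw [h2] at h1
    exact h1.unique (hasDerivAt_const r 0)
  have him : ∀ r : ℝ, HasDerivAt (fun r : ℝ => (F (γ (a + r * (b - a)))).im)
      (((b - a : ℝ) : ℂ) * (deriv F (γ (a + r * (b - a))) * deriv γ (a + r * (b - a)))).im r :=
    fun r => by
      simpa [Function.comp_def] using Complex.imCLM.hasFDerivAt.comp_hasDerivAt r (hd r)
  have key : ∀ x ∈ Icc (0 : ℝ) 1, ∀ y ∈ Icc (0 : ℝ) 1, x < y →
      (F (γ (a + x * (b - a)))).im ≠ (F (γ (a + y * (b - a)))).im := by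
    intro x hx y hy hxy heq
    obtain ⟨r, hr, hr0⟩ := exists_hasDerivAt_eq_zero hxy
      (fun r _ => (him r).continuousAt.continuousWithinAt) heq fun r _ => him r
    have hzero : ((b - a : ℝ) : ℂ) * (deriv F (γ (a + r * (b - a))) *
        deriv γ (a + r * (b - a))) = 0 := Complex.ext (hre r) hr0
    have hr_pos : 0 < r := hx.1.trans_lt hr.1
    refine mul_ne_zero (Complex.ofReal_ne_zero.2 hba) (mul_ne_zero ?_ (hγ.regular _)) hzero
    refine hcrit _ (hγ.mem _) fun h => ?_
    have := hγi (h.trans ha.symm)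
    exact mul_ne_zero hr_pos.ne' hba (by linarith)
  intro x hx y hy h
  rcases lt_trichotomy x y with h1 | h1 | h1
  · exact absurd h (key x hx y hy h1)
  · exact h1
  · exact absurd h.symm (key y hy x hx h1)

theorem ne_zero_of_nodal (hF : AnalyticOnNhd ℂ F (Metric.ball 0 R))
    (hnc : ¬ ∃ a : ℝ, ∀ z ∈ Metric.ball (0 : ℂ) R, (F z).re = a)
    (hcov : ∀ z ∈ nodalSet (fun z => (F z).re) (Metric.ball 0 R), ∃ γ : ℝ → ℂ,
      IsRegularAnalyticCurveIn (fun z => (F z).re) (Metric.ball 0 R) γ ∧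
        z ∈ range γ ∧ p ∈ range γ)
    (hp : F p = 0) {z : ℂ} (hz : z ∈ Metric.ball (0 : ℂ) R) (hzp : z ≠ p) : F z ≠ 0 := by
  intro h0
  obtain ⟨γ, hγ, ⟨b, hb⟩, ⟨a, ha⟩⟩ := hcov z ⟨hz, by simp [h0]⟩
  have hab : b ≠ a := fun h => hzp (by rw [← hb, ← ha, h])
  have := injOn_im_along_curve (fun z hz hzp => deriv_ne_zero_of_nodal hF hnc hcov hz hzp) hF hγ
    (hγ.injective hF hnc) ha hab ⟨le_rfl, zero_le_one⟩ ⟨zero_le_one, le_rfl⟩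
    (by simp [ha, hb, hp, h0])
  exact zero_ne_one this

/-- The arc from `p` to `z` is reparametrised by the value of `Im F`, which increases from `0` to
`s` along it. -/
theorem exists_lift (hF : AnalyticOnNhd ℂ F (Metric.ball 0 R))
    (hnc : ¬ ∃ a : ℝ, ∀ z ∈ Metric.ball (0 : ℂ) R, (F z).re = a)
    (hcov : ∀ z ∈ nodalSet (fun z => (F z).re) (Metric.ball 0 R), ∃ γ : ℝ → ℂ,
      IsRegularAnalyticCurveIn (fun z => (F z).re) (Metric.ball 0 R) γ ∧
        z ∈ range γ ∧ p ∈ range γ)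
    (hp : F p = 0) {s : ℝ} (hs : 0 < s) {z : ℂ} (hz : z ∈ Metric.ball (0 : ℂ) R)
    (hzs : F z = Complex.I * s) :
    ∃ σ : ℝ → ℂ, Continuous σ ∧ σ 0 = p ∧ σ s = z ∧
      ∀ x ∈ Icc 0 s, σ x ∈ Metric.ball (0 : ℂ) R ∧ F (σ x) = Complex.I * x := by
  obtain ⟨γ, hγ, ⟨b, hb⟩, ⟨a, ha⟩⟩ := hcov z ⟨hz, by simp [hzs]⟩
  have hzp : z ≠ p := by
    rintro rfl
    rw [hp] at hzs
    exact hs.ne' (by simpa using hzs.symm)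
  have hab : b ≠ a := fun h => hzp (by rw [← hb, ← ha, h])
  have hcrit : ∀ z ∈ nodalSet (fun z => (F z).re) (Metric.ball 0 R), z ≠ p → deriv F z ≠ 0 :=
    fun z hz hzp => deriv_ne_zero_of_nodal hF hnc hcov hz hzp
  have hinj := injOn_im_along_curve hcrit hF hγ (hγ.injective hF hnc) ha hab
  have hlin : Continuous fun r : ℝ => γ (a + r * (b - a)) := hγ.continuous.comp (by fun_prop)
  have hcont : Continuous fun r : ℝ => (F (γ (a + r * (b - a)))).im :=
    Complex.continuous_im.comp (continuous_iff_continuousAt.2 fun r =>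
      (hF _ (hγ.mem _).1).continuousAt.comp_of_eq hlin.continuousAt rfl)
  obtain ⟨g, hg, hgx⟩ := continuous_inverse_of_injOn_Icc hs.le hcont.continuousOn hinj
    (by simp [ha, hp]) (by simp [hb, hzs])
  have h0 := hgx 0 ⟨le_rfl, hs.le⟩
  have h1 := hgx s ⟨hs.le, le_rfl⟩
  have hg0 : g 0 = 0 := hinj h0.1 ⟨le_rfl, zero_le_one⟩ (h0.2.trans (by simp [ha, hp]))
  have hg1 : g s = 1 := hinj h1.1 ⟨zero_le_one, le_rfl⟩ (h1.2.trans (by simp [hb, hzs]))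
  refine ⟨fun x => γ (a + g x * (b - a)), hlin.comp hg, by simp [hg0, ha], by simp [hg1, hb],
    fun x hx => ⟨(hγ.mem _).1, Complex.ext ?_ ?_⟩⟩
  · simpa using (hγ.mem _).2
  · simpa using (hgx x hx).2

/-- If every point of the zero set of `Re F` is joined to the zero `p` of order `n` by a regular
analytic curve in the zero set, then `F` takes each positive imaginary value at most `n` times. -/
theorem card_le_of_nodal (hF : AnalyticOnNhd ℂ F (Metric.ball 0 R))
    (hnc : ¬ ∃ a : ℝ, ∀ z ∈ Metric.ball (0 : ℂ) R, (F z).re = a)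
    (hcov : ∀ z ∈ nodalSet (fun z => (F z).re) (Metric.ball 0 R), ∃ γ : ℝ → ℂ,
      IsRegularAnalyticCurveIn (fun z => (F z).re) (Metric.ball 0 R) γ ∧
        z ∈ range γ ∧ p ∈ range γ)
    (hp : F p = 0) (hpR : p ∈ Metric.ball (0 : ℂ) R) {n : ℕ} (hn : n ≠ 0)
    (hord : analyticOrderAt F p = n) {s : ℝ} (hs : 0 < s) (T : Finset ℂ)
    (hT : ∀ z ∈ T, z ∈ Metric.ball (0 : ℂ) R ∧ F z = Complex.I * s) : T.card ≤ n := by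
  have hlift : ∀ z ∈ T, ∃ σ : ℝ → ℂ, Continuous σ ∧ σ 0 = p ∧ σ s = z ∧
      ∀ x ∈ Icc 0 s, σ x ∈ Metric.ball (0 : ℂ) R ∧ F (σ x) = Complex.I * x :=
    fun z hz => exists_lift hF hnc hcov hp hs (hT z hz).1 (hT z hz).2
  choose! σ hσc hσ0 hσs hσx using hlift
  -- Two lifts that meet above some `x₀ > 0` stay together up to `s`: agreement is closed, and it
  -- propagates to the right because `F` is locally injective at the non-critical points above `x >
  -- 0`.
  have hdist : ∀ z ∈ T, ∀ w ∈ T, ∀ x ∈ Ioc 0 s, σ z x = σ w x → z = w := by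
    intro z hz w hw x₀ hx₀ heq
    have hsub : Icc x₀ s ⊆ {x | σ z x = σ w x} := by
      refine IsClosed.Icc_subset_of_forall_exists_gt ?_ heq ?_
      · exact (isClosed_eq (hσc z hz) (hσc w hw)).inter isClosed_Icc
      · rintro x ⟨hx, hxI⟩ y hy
        have hx' : σ z x = σ w x := hx
        have hx_pos : 0 < x := hx₀.1.trans_le hxI.1
        have hxs := hσx z hz x ⟨hx_pos.le, hxI.2.le⟩
        have hxp : σ z x ≠ p := by
          intro h
          rw [h, hp] at hxs
          exact hx_pos.ne' (by simpa using hxs.2.symm)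
        have hder : deriv F (σ z x) ≠ 0 :=
          deriv_ne_zero_of_nodal hF hnc hcov ⟨hxs.1, by simp [hxs.2]⟩ hxp
        have h1 := (hF _ hxs.1).hasStrictDerivAt.eventually_injective hder
        have h2 : Tendsto (fun y => (σ z y, σ w y)) (𝓝 x) (𝓝 (σ z x, σ z x)) := by
          have := ((hσc z hz).prodMk (hσc w hw)).tendsto x
          rwa [← hx'] at this
        have h3 : ∀ᶠ y in 𝓝[>] x, F (σ z y) = F (σ w y) → σ z y = σ w y :=
          nhdsWithin_le_nhds (h2.eventually h1)
        obtain ⟨r, hr, hr2⟩ := (h3.and (Ioc_mem_nhdsGT (lt_min hy hxI.2))).exists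
        have hrs : r ∈ Icc 0 s :=
          ⟨(hx_pos.trans hr2.1).le, hr2.2.trans (min_le_right _ _)⟩
        exact ⟨r, hr ((hσx z hz r hrs).2.trans (hσx w hw r hrs).2.symm), hr2.1,
          hr2.2.trans (min_le_left _ _)⟩
    have : σ z s = σ w s := hsub ⟨hx₀.2, le_rfl⟩
    rwa [hσs z hz, hσs w hw] at this
  have hord' : analyticOrderAt (fun z => F z - F p) p = n := by
    simpa [hp] using hord
  obtain ⟨χ, hχ, -, hχ', hFχ⟩ := exists_local_coordinate (hF p hpR) hn hord'
  simp only [hp, zero_add] at hFχ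
  have hinj := hχ.hasStrictDerivAt.eventually_injective hχ'
  have hσp : ∀ z ∈ T, Tendsto (σ z) (𝓝[>] 0) (𝓝 p) := by
    intro z hz
    have := (hσc z hz).tendsto 0
    rw [hσ0 z hz] at this
    exact this.mono_left nhdsWithin_le_nhds
  have e1 : ∀ᶠ x in 𝓝[>] 0, ∀ z ∈ T, F (σ z x) = χ (σ z x) ^ n :=
    (Finset.eventually_all T).2 fun z hz => (hσp z hz).eventually hFχ
  have e2 : ∀ᶠ x in 𝓝[>] 0, ∀ z ∈ T, ∀ w ∈ T, χ (σ z x) = χ (σ w x) → σ z x = σ w x :=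
    (Finset.eventually_all T).2 fun z hz => (Finset.eventually_all T).2 fun w hw => by
      have h := (hσp z hz).prodMk_nhds (hσp w hw)
      exact h.eventually hinj
  -- For small `x > 0` all lifts lie in the coordinate patch at `p`, where their `χ`-values are
  -- distinct `n`-th roots of `ix`.
  obtain ⟨x, ⟨hx1, hx2⟩, hx3⟩ := ((e1.and e2).and (Ioc_mem_nhdsGT hs)).exists
  classical
  calc T.card ≤ (Polynomial.nthRoots n (Complex.I * x)).toFinset.card := by
        refine Finset.card_le_card_of_injOn (fun z => χ (σ z x)) ?_ ?_
        · intro z hz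
          have hz : z ∈ T := hz
          simp only [Finset.mem_coe, Multiset.mem_toFinset,
            Polynomial.mem_nthRoots (Nat.pos_of_ne_zero hn)]
          rw [← hx1 z hz, (hσx z hz x ⟨hx3.1.le, hx3.2⟩).2]
        · intro z hz w hw h
          exact hdist z hz w hw x hx3 (hx2 z hz w hw h)
    _ ≤ Multiset.card (Polynomial.nthRoots n (Complex.I * x)) := Multiset.toFinset_card_le _
    _ ≤ n := Polynomial.card_nthRoots n _

end Star

/-! ### Bounded characteristic from the counting bound -/

theorem integrable_posLog_abs_inv : Integrable (fun s : ℝ => Real.posLog |s|⁻¹) := by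
  have h1 : IntegrableOn (fun s : ℝ => -Real.log s) (Ioc (-1) 1) :=
    ((intervalIntegrable_iff_integrableOn_Ioc_of_le (by norm_num)).1
      (intervalIntegral.intervalIntegrable_log' (a := -1) (b := 1))).neg
  have h2 : (fun s : ℝ => Real.posLog |s|⁻¹) = (Ioc (-1) 1).indicator fun s => -Real.log s := by
    funext s
    by_cases hs : s ∈ Ioc (-1 : ℝ) 1
    · rw [indicator_of_mem hs]
      rcases eq_or_ne s 0 with rfl | h0
      · simp
      · rw [Real.posLog_eq_log, Real.log_inv, Real.log_abs]
        rw [abs_inv, abs_abs]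
        exact (one_le_inv₀ (abs_pos.2 h0)).2 (abs_le.2 ⟨hs.1.le, hs.2⟩)
    · rw [indicator_of_notMem hs, Real.posLog_eq_zero_iff, abs_inv, abs_abs]
      refine inv_le_one_of_one_le₀ ?_
      by_contra hlt
      exact hs ⟨(abs_lt.1 (not_le.1 hlt)).1, (abs_lt.1 (not_le.1 hlt)).2.le⟩
  rw [h2]
  exact h1.integrable_indicator measurableSet_Ioc

/-- Lets the exchange of the integrals in `s` and `θ` be done by Tonelli, without prior
integrability. -/
theorem circleAverage_eq_toReal_lintegral {g : ℂ → ℝ} {c : ℂ} {r : ℝ} (hg : ∀ z, 0 ≤ g z)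
    (hm : AEStronglyMeasurable (fun θ : ℝ => g (circleMap c r θ))
      (volume.restrict (Ioc 0 (2 * Real.pi)))) :
    Real.circleAverage g c r = (2 * Real.pi)⁻¹ *
      (∫⁻ θ in Ioc 0 (2 * Real.pi), ENNReal.ofReal (g (circleMap c r θ))).toReal := by
  rw [Real.circleAverage_def, smul_eq_mul, intervalIntegral.integral_of_le Real.two_pi_pos.le,
    integral_eq_lintegral_of_nonneg_ae (Eventually.of_forall fun _ => hg _) hm]

/-- For any function on a circle, some value `i s`, `s ∈ [2, 3]`, is not approached too closely on
average. -/
theorem exists_circleAverage_posLog_inv_le {f : ℂ → ℂ} {r : ℝ}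
    (hf : Continuous fun θ : ℝ => f (circleMap 0 r θ)) :
    ∃ s ∈ Icc (2 : ℝ) 3, Real.circleAverage (fun z => Real.posLog ‖f z - Complex.I * s‖⁻¹) 0 r ≤
      ∫ s : ℝ, Real.posLog |s|⁻¹ := by
  set G : ℝ → ℝ → ℝ := fun s θ => Real.posLog ‖f (circleMap 0 r θ) - Complex.I * s‖⁻¹ with hG
  have hGm : Measurable (Function.uncurry G) := by
    refine Real.continuous_posLog.measurable.comp (Measurable.inv (Measurable.norm ?_))
    refine Continuous.measurable ?_
    exact (hf.comp continuous_snd).sub (by fun_prop)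
  set K : ENNReal := ∫⁻ s : ℝ, ENNReal.ofReal (Real.posLog |s|⁻¹) with hK
  have hKtop : K < ⊤ := integrable_posLog_abs_inv.lintegral_lt_top
  -- Since `|f - is| ≥ |Im f - s|`, translation invariance on the whole line gives a bound
  -- independent of `f` and `θ`.
  have hinner : ∀ θ, ∫⁻ s in Icc (2 : ℝ) 3, ENNReal.ofReal (G s θ) ≤ K := by
    intro θ
    calc ∫⁻ s in Icc (2 : ℝ) 3, ENNReal.ofReal (G s θ)
        ≤ ∫⁻ s, ENNReal.ofReal (G s θ) := setLIntegral_le_lintegral _ _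
      _ ≤ ∫⁻ s : ℝ, ENNReal.ofReal (Real.posLog |(f (circleMap 0 r θ)).im - s|⁻¹) := by
          refine lintegral_mono_ae ?_
          filter_upwards [Measure.ae_ne volume (f (circleMap 0 r θ)).im] with s hs
          refine ENNReal.ofReal_le_ofReal (Real.posLog_le_posLog (by positivity) ?_)
          refine inv_anti₀ (abs_pos.2 (sub_ne_zero.2 hs.symm)) ?_
          simpa using Complex.abs_im_le_norm (f (circleMap 0 r θ) - Complex.I * s)
      _ = K := lintegral_sub_left_eq_self
          (fun s : ℝ => ENNReal.ofReal (Real.posLog |s|⁻¹)) _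
  have houter : ∫⁻ s in Icc (2 : ℝ) 3, ∫⁻ θ in Ioc 0 (2 * Real.pi), ENNReal.ofReal (G s θ) ≤
      K * ENNReal.ofReal (2 * Real.pi) := by
    rw [lintegral_lintegral_swap hGm.ennreal_ofReal.aemeasurable]
    refine (lintegral_mono hinner).trans ?_
    rw [setLIntegral_const, Real.volume_Ioc, sub_zero]
  have hvol : volume (Icc (2 : ℝ) 3) = 1 := by
    rw [Real.volume_Icc]; norm_num
  -- Some `s` does no worse than the average, which equals the integral because `[2, 3]` has length
  -- `1`.
  obtain ⟨s, hs, hle⟩ := exists_le_setLAverage (μ := volume) (s := Icc (2 : ℝ) 3)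
    (f := fun s => ∫⁻ θ in Ioc 0 (2 * Real.pi), ENNReal.ofReal (G s θ))
    (by simp [hvol]) (by simp [hvol]) hGm.ennreal_ofReal.lintegral_prod_right'.aemeasurable
  rw [setLAverage_eq, hvol, div_one] at hle
  have hle' := hle.trans houter
  refine ⟨s, hs, ?_⟩
  have hms : Measurable (G s) := hGm.of_uncurry_left
  rw [circleAverage_eq_toReal_lintegral (fun _ => Real.posLog_nonneg)
    hms.aestronglyMeasurable,
    integral_eq_lintegral_of_nonneg_ae (Eventually.of_forall fun _ => Real.posLog_nonneg)
      integrable_posLog_abs_inv.aestronglyMeasurable]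
  have h3 := ENNReal.toReal_mono
    (ENNReal.mul_ne_top hKtop.ne ENNReal.ofReal_ne_top) hle'
  rw [ENNReal.toReal_mul, ENNReal.toReal_ofReal Real.two_pi_pos.le] at h3
  rw [inv_mul_le_iff₀ Real.two_pi_pos]
  exact h3.trans_eq (mul_comm _ _)

/-- In Jensen's formula each zero `u` is simple and contributes `log (r / |u|) ≤ log (r / ρ)`, and
there are at most `n` of them. -/
theorem circleAverage_log_le_of_card_le {g : ℂ → ℂ} {r ρ : ℝ} {n : ℕ} (hr : 0 < r) (hρ : 0 < ρ)
    (hρr : ρ ≤ r) (hg : AnalyticOnNhd ℂ g (Metric.closedBall 0 r))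
    (hsimple : ∀ z ∈ Metric.closedBall (0 : ℂ) r, g z = 0 → ρ ≤ ‖z‖ ∧ deriv g z ≠ 0)
    (hcard : ∀ T : Finset ℂ, (∀ z ∈ T, z ∈ Metric.closedBall (0 : ℂ) r ∧ g z = 0) → T.card ≤ n) :
    Real.circleAverage (fun z => Real.log ‖g z‖) 0 r ≤ n * Real.log (r / ρ) + Real.log ‖g 0‖ := by
  have hr' : |r| = r := abs_of_pos hr
  have hg0 : g 0 ≠ 0 := fun h => by
    have := (hsimple 0 (by simp [hr.le]) h).1
    simp only [norm_zero] at this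
    exact absurd this (not_le.2 hρ)
  have hgr : AnalyticOnNhd ℂ g (Metric.closedBall 0 |r|) := by rwa [hr']
  rw [hgr.circleAverage_log_norm hr.ne' hg0, hr']
  gcongr
  set D := MeromorphicOn.divisor g (Metric.closedBall 0 r) with hD
  have hDu : ∀ u, D u ≠ 0 → u ∈ Metric.closedBall (0 : ℂ) r ∧ g u = 0 ∧ D u = 1 := by
    intro u hu
    have hmem : u ∈ Metric.closedBall (0 : ℂ) r := by
      by_contra h
      exact hu (D.apply_eq_zero_of_notMem h)
    have hval : D u = _ := MeromorphicOn.AnalyticOnNhd.divisor_apply hg hmem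
    have hgu : g u = 0 := by
      by_contra h
      rw [(hg u hmem).analyticOrderAt_eq_zero.2 h] at hval
      exact hu (by simpa using hval)
    rw [(hg u hmem).analyticOrderAt_eq_one_of_zero_deriv_ne_zero hgu (hsimple u hmem hgu).2] at hval
    exact ⟨hmem, hgu, by simpa using hval⟩
  have hfin : (Function.support D).Finite :=
    D.finiteSupport (isCompact_closedBall 0 r)
  rw [finsum_eq_sum_of_support_subset (s := hfin.toFinset) _ (by
    intro u hu
    simp only [Finite.coe_toFinset]
    intro h
    exact hu (by simp [h]))]
  have hlog : 0 ≤ Real.log (r / ρ) := Real.log_nonneg ((one_le_div hρ).2 hρr)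
  calc ∑ u ∈ hfin.toFinset, (D u : ℝ) * Real.log (r * ‖0 - u‖⁻¹)
      ≤ ∑ _u ∈ hfin.toFinset, Real.log (r / ρ) := by
        refine Finset.sum_le_sum fun u hu => ?_
        obtain ⟨h1, h2, h3⟩ := hDu u (by simpa using hu)
        have h4 := (hsimple u h1 h2).1
        have h5 : 0 < ‖u‖ := hρ.trans_le h4
        rw [h3, Int.cast_one, one_mul, zero_sub, norm_neg, ← div_eq_mul_inv]
        gcongr
    _ = hfin.toFinset.card * Real.log (r / ρ) := by rw [Finset.sum_const, nsmul_eq_mul]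
    _ ≤ n * Real.log (r / ρ) := by
        gcongr
        refine hcard _ fun u hu => ?_
        obtain ⟨h1, h2, h3⟩ := hDu u (by simpa using hu)
        exact ⟨h1, h2⟩

/-- A holomorphic function that is bounded by `1` near the origin and takes the imaginary values
`i s`, `2 ≤ s ≤ 3`, at most `n` times has bounded characteristic. -/
theorem circleAverage_posLog_le_of_card_le {f : ℂ → ℂ} {r ρ : ℝ} {n : ℕ} (hr : 0 < r) (hρ : 0 < ρ)
    (hρr : ρ ≤ r) (hf : AnalyticOnNhd ℂ f (Metric.closedBall 0 r)) (hf0 : f 0 = 0)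
    (hbd : ∀ z ∈ Metric.closedBall (0 : ℂ) ρ, ‖f z‖ ≤ 1)
    (hsimple : ∀ z ∈ Metric.closedBall (0 : ℂ) r, z ≠ 0 → (f z).re = 0 → deriv f z ≠ 0)
    (hcard : ∀ s : ℝ, 0 < s → ∀ T : Finset ℂ,
      (∀ z ∈ T, z ∈ Metric.closedBall (0 : ℂ) r ∧ f z = Complex.I * s) → T.card ≤ n) :
    Real.circleAverage (fun z => Real.posLog ‖f z‖) 0 r ≤
      n * Real.log (r / ρ) + 2 * Real.log 3 + Real.log 2 + ∫ s : ℝ, Real.posLog |s|⁻¹ := by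
  have hsph : Metric.sphere (0 : ℂ) |r| ⊆ Metric.closedBall 0 r := by
    rw [abs_of_pos hr]; exact Metric.sphere_subset_closedBall
  have hcont : Continuous fun θ : ℝ => f (circleMap 0 r θ) :=
    continuous_iff_continuousAt.2 fun θ =>
      (hf _ (hsph (circleMap_mem_sphere' 0 r θ))).continuousAt.comp_of_eq
        (continuous_circleMap 0 r).continuousAt rfl
  obtain ⟨s, hs, hsle⟩ := exists_circleAverage_posLog_inv_le hcont
  have hs0 : 0 < s := by linarith [hs.1]
  set g : ℂ → ℂ := fun z => f z - Complex.I * s with hg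
  have hga : AnalyticOnNhd ℂ g (Metric.closedBall 0 r) := fun z hz => (hf z hz).sub analyticAt_const
  have hIs : ‖Complex.I * (s : ℂ)‖ = s := by simp [abs_of_pos hs0]
  have hjensen := circleAverage_log_le_of_card_le hr hρ hρr hga (fun z hz hz0 => by
      have hfz : f z = Complex.I * s := sub_eq_zero.1 hz0
      refine ⟨?_, ?_⟩
      · by_contra hlt
        have := hbd z (by simpa using (not_le.1 hlt).le)
        rw [hfz, hIs] at this
        linarith [hs.1]
      · rw [hg, deriv_sub_const]
        refine hsimple z hz ?_ (by simp [hfz])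
        rintro rfl
        rw [hf0] at hfz
        exact hs0.ne' (by simpa using hfz.symm))
    (fun T hT => hcard s hs0 T fun z hz => ⟨(hT z hz).1, sub_eq_zero.1 (hT z hz).2⟩)
  have hg0 : ‖g 0‖ = s := by simp [hg, hf0, abs_of_pos hs0]
  have hmer : MeromorphicOn g (Metric.sphere 0 |r|) := (hga.mono hsph).meromorphicOn
  have hmerf : MeromorphicOn f (Metric.sphere 0 |r|) := (hf.mono hsph).meromorphicOn
  have i1 : CircleIntegrable (fun z => Real.log ‖g z‖) 0 r := hmer.circleIntegrable_log_norm
  have i2 : CircleIntegrable (fun z => Real.posLog ‖g z‖⁻¹) 0 r := by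
    have := hmer.inv.circleIntegrable_posLog_norm
    simpa using this
  have i3 : CircleIntegrable (fun z => Real.posLog ‖f z‖) 0 r := hmerf.circleIntegrable_posLog_norm
  have hlog3 : Real.log s ≤ Real.log 3 := Real.log_le_log hs0 hs.2
  -- Uses `f = g + is` and `log⁺ x = log x + log⁺ x⁻¹`. One `log 3` comes from `log⁺ s` here, the
  -- other from `log |g 0| = log s` in Jensen's formula.
  have hpt : ∀ z, Real.posLog ‖f z‖ ≤
      (Real.log ‖g z‖ + Real.posLog ‖g z‖⁻¹) + (Real.log 3 + Real.log 2) := by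
    intro z
    have h1 := Real.posLog_norm_add_le (g z) (Complex.I * s)
    rw [show g z + Complex.I * s = f z by simp [hg], hIs,
      Real.posLog_eq_log (x := s) (by rw [abs_of_pos hs0]; linarith [hs.1])] at h1
    have h2 := Real.posLog_sub_posLog_inv (x := ‖g z‖)
    linarith
  have hsum := Real.circleAverage_mono (c := 0) (R := r) i3
    ((i1.add i2).add (circleIntegrable_const _ 0 r)) fun z _ => hpt z
  rw [Real.circleAverage_add (i1.add i2) (circleIntegrable_const _ 0 r),
    Real.circleAverage_add i1 i2, Real.circleAverage_const] at hsum
  rw [hg0] at hjensen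
  linarith

/-! ### The exponent `H` and its derivatives -/

/-- Take a primitive `H` of `h' / h` with `H 0 = log (h 0)`; then `h exp (-H)` has zero derivative
and equals `1` at the origin. -/
theorem exists_eq_exp_of_ne_zero {h : ℂ → ℂ} {R : ℝ} (hR : 0 < R)
    (hh : AnalyticOnNhd ℂ h (Metric.ball 0 R)) (h0 : ∀ z ∈ Metric.ball (0 : ℂ) R, h z ≠ 0) :
    ∃ H : ℂ → ℂ, AnalyticOnNhd ℂ H (Metric.ball 0 R) ∧
      ∀ z ∈ Metric.ball (0 : ℂ) R, h z = Complex.exp (H z) := by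
  have hd : DifferentiableOn ℂ (fun z => deriv h z / h z) (Metric.ball 0 R) := fun z hz =>
    ((hh z hz).deriv.differentiableAt.div (hh z hz).differentiableAt
      (h0 z hz)).differentiableWithinAt
  obtain ⟨H, hH0, hH⟩ := hd.isExactOn_ball.with_val_at 0 (Complex.log (h 0))
  refine ⟨H, DifferentiableOn.analyticOnNhd
    (fun z hz => (hH z hz).differentiableAt.differentiableWithinAt) Metric.isOpen_ball, ?_⟩
  have h0R : (0 : ℂ) ∈ Metric.ball (0 : ℂ) R := Metric.mem_ball_self hR
  have hder : ∀ z ∈ Metric.ball (0 : ℂ) R,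
      HasDerivAt (fun z => h z * Complex.exp (-H z)) 0 z := by
    intro z hz
    have h1 : HasDerivAt (fun z => h z * Complex.exp (-H z)) _ z :=
      (hh z hz).differentiableAt.hasDerivAt.mul (hH z hz).neg.cexp
    convert h1 using 1
    have := h0 z hz
    simp only [Pi.neg_apply]
    field_simp
    ring
  intro z hz
  have hconst := Metric.isOpen_ball.is_const_of_deriv_eq_zero
    (convex_ball (0 : ℂ) R).isPreconnected
    (fun z hz => (hder z hz).differentiableAt.differentiableWithinAt)
    (fun z hz => (hder z hz).deriv) hz h0R
  simp only [hH0, Complex.exp_neg, Complex.exp_log (h0 0 h0R), mul_inv_cancel₀ (h0 0 h0R)] at hconst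
  exact (mul_inv_eq_one₀ (Complex.exp_ne_zero _)).1 hconst

theorem exists_eq_pow_mul_exp {f : ℂ → ℂ} {R : ℝ} {n : ℕ} (hR : 0 < R)
    (hf : AnalyticOnNhd ℂ f (Metric.ball 0 R)) (h0 : ∀ z ∈ Metric.ball (0 : ℂ) R, z ≠ 0 → f z ≠ 0)
    (hord : analyticOrderAt f 0 = n) :
    ∃ H : ℂ → ℂ, AnalyticOnNhd ℂ H (Metric.ball 0 R) ∧
      ∀ z ∈ Metric.ball (0 : ℂ) R, f z = z ^ n * Complex.exp (H z) := by
  have h0R : (0 : ℂ) ∈ Metric.ball (0 : ℂ) R := Metric.mem_ball_self hR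
  obtain ⟨g, hg, hg0, hfg⟩ := (hf 0 h0R).analyticOrderAt_eq_natCast.1 hord
  simp only [sub_zero, smul_eq_mul] at hfg
  -- The singularity of `f / zⁿ` at `0` is removable, and the local factor `g` supplies the missing
  -- value.
  set h : ℂ → ℂ := Function.update (fun z => f z / z ^ n) 0 (g 0) with hh
  have hh0 : h 0 = g 0 := by simp [hh]
  have hhne : ∀ z, z ≠ 0 → h z = f z / z ^ n := fun z hz => by simp [hh, hz]
  have hfh : ∀ z, z ≠ 0 → f z = z ^ n * h z := fun z hz => by
    rw [hhne z hz, mul_div_cancel₀ _ (pow_ne_zero n hz)]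
  have hha : AnalyticOnNhd ℂ h (Metric.ball 0 R) := by
    intro z hz
    rcases eq_or_ne z 0 with rfl | hz0
    · refine hg.congr ?_
      filter_upwards [hfg] with w hw
      rcases eq_or_ne w 0 with rfl | hw0
      · exact hh0.symm
      · rw [hhne w hw0, hw, mul_div_cancel_left₀ _ (pow_ne_zero n hw0)]
    · refine ((hf z hz).div (analyticAt_id.pow n) (pow_ne_zero n hz0)).congr ?_
      filter_upwards [isOpen_ne.mem_nhds hz0] with w hw
      simp [hhne w hw]
  have hhz : ∀ z ∈ Metric.ball (0 : ℂ) R, h z ≠ 0 := by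
    intro z hz
    rcases eq_or_ne z 0 with rfl | hz0
    · rwa [hh0]
    · rw [hhne z hz0]
      exact div_ne_zero (h0 z hz hz0) (pow_ne_zero n hz0)
  obtain ⟨H, hHa, hH⟩ := exists_eq_exp_of_ne_zero hR hha hhz
  refine ⟨H, hHa, fun z hz => ?_⟩
  rw [← hH z hz]
  rcases eq_or_ne z 0 with rfl | hz0
  · rw [hh0]; exact hfg.self_of_nhds
  · exact hfh z hz0

/-- Poisson's formula bounds a harmonic function from above by the mean of a majorant. -/
theorem re_le_three_mul_circleAverage {H : ℂ → ℂ} {B : ℂ → ℝ} {r : ℝ}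
    (hH : AnalyticOnNhd ℂ H (Metric.closedBall 0 r)) (hB : CircleIntegrable B 0 r)
    (hB0 : ∀ z, 0 ≤ B z) (hHB : ∀ z ∈ Metric.sphere (0 : ℂ) r, (H z).re ≤ B z) {w : ℂ}
    (hw : w ∈ Metric.ball (0 : ℂ) (r / 2)) : (H w).re ≤ 3 * Real.circleAverage B 0 r := by
  have hwn : ‖w‖ < r / 2 := by simpa using hw
  have hr : 0 < r := by linarith [norm_nonneg w]
  have hr' : |r| = r := abs_of_pos hr
  have hwr : w ∈ Metric.ball (0 : ℂ) r := Metric.ball_subset_ball (by linarith) hw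
  have hharm : InnerProductSpace.HarmonicOnNhd (fun z => (H z).re) (Metric.closedBall 0 r) :=
    fun z hz => (hH z hz).harmonicAt_re
  rw [← hharm.circleAverage_re_herglotzRieszKernel_smul hwr,
    show 3 * Real.circleAverage B 0 r = Real.circleAverage (fun z => 3 * B z) 0 r by
      simpa using (Real.circleAverage_fun_smul (a := (3 : ℝ)) (f := B) (c := 0) (R := r)).symm]
  refine Real.circleAverage_mono ?_ ?_ ?_
  · have hk := continuousOn_herglotzRieszKernel_sphere hwr
    rw [hr'] at hk
    refine ContinuousOn.circleIntegrable hr.le (ContinuousOn.smul ?_ ?_)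
    · exact Complex.continuous_re.comp_continuousOn hk
    · exact Complex.continuous_re.comp_continuousOn
        (hH.mono Metric.sphere_subset_closedBall).continuousOn
  · exact hB.const_smul (a := (3 : ℝ))
  · intro z hz
    rw [hr'] at hz
    have h1 := re_herglotzRieszKernel_le hz hwr
    have h2 := le_re_herglotzRieszKernel hz hwr
    simp only [sub_zero] at h1 h2
    -- For `|w| < r / 2` the Poisson kernel lies between `0` and `3`. Its sign allows `Re H` to be
    -- replaced by `B`, and `B ≥ 0` then allows the kernel to be replaced by `3`.
    have h3 : (r + ‖w‖) / (r - ‖w‖) ≤ 3 := by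
      rw [div_le_iff₀ (by linarith)]; linarith
    have h4 : 0 ≤ (r - ‖w‖) / (r + ‖w‖) := div_nonneg (by linarith) (by positivity)
    have h5 : ((Complex.re ∘ herglotzRieszKernel 0 w) • fun z => (H z).re) z =
        ((z + w) / (z - w)).re * (H z).re := by
      simp [herglotzRieszKernel_def]
    rw [h5]
    calc ((z + w) / (z - w)).re * (H z).re ≤ ((z + w) / (z - w)).re * B z :=
          mul_le_mul_of_nonneg_left (hHB z hz) (h4.trans h2)
      _ ≤ 3 * B z := mul_le_mul_of_nonneg_right (h1.trans h3) (hB0 z)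

/-- Borel–Carathéodory needs a lower bound for `Re H 0`. At `z₀` its factor is at most `2 (1/16) /
(1/4 - 1/16) = 2/3 < 1`, so `Re H z₀ ≥ 0` gives `M ≤ 3 (A + 1)`. Two Cauchy estimates of radius
`1/32` then produce `64 M` and `2048 M`. -/
theorem norm_deriv_le_of_re_le {H : ℂ → ℂ} {A : ℝ} (hH : AnalyticOnNhd ℂ H (Metric.ball 0 1))
    (hA : ∀ w ∈ Metric.ball (0 : ℂ) (1 / 4), (H w).re ≤ A)
    (hz₀ : ∃ z₀ ∈ Metric.closedBall (0 : ℂ) (1 / 16), 0 ≤ (H z₀).re) {z : ℂ} (hz : ‖z‖ ≤ 1 / 32) :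
    ‖deriv H z‖ ≤ 6144 * (A + 1) ∧ ‖deriv (deriv H) z‖ ≤ 6144 * (A + 1) := by
  obtain ⟨z₀, hz₀, hz₀H⟩ := hz₀
  have h0A : (H 0).re ≤ A := hA 0 (Metric.mem_ball_self (by norm_num))
  set M := A - (H 0).re + 1 with hM
  have hM0 : 0 < M := by linarith
  have hd : DifferentiableOn ℂ (fun z => H z - H 0) (Metric.ball 0 (1 / 4)) :=
    (hH.differentiableOn.mono (Metric.ball_subset_ball (by norm_num))).sub_const _
  have hBC : ∀ w ∈ Metric.ball (0 : ℂ) (1 / 4), ‖H w - H 0‖ ≤ 2 * M * ‖w‖ / (1 / 4 - ‖w‖) :=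
    fun w hw => Complex.borelCaratheodory_zero (f := fun z => H z - H 0) hM0 hd
      (fun x hx => by
        show (H x - H 0).re ≤ M
        rw [Complex.sub_re]
        linarith [hA x hx]) (by norm_num) hw (by simp)
  have hz₀n : ‖z₀‖ ≤ 1 / 16 := by simpa using hz₀
  have h1 : ‖H z₀ - H 0‖ ≤ 2 / 3 * M := by
    refine (hBC z₀ (by simp only [Metric.mem_ball, dist_zero_right]; linarith)).trans ?_
    rw [div_le_iff₀ (by linarith)]
    nlinarith
  have h2 : (H z₀).re - (H 0).re ≤ 2 / 3 * M := by
    rw [← Complex.sub_re]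
    exact (Complex.re_le_norm _).trans h1
  have hMA : M ≤ 3 * (A + 1) := by linarith
  have h3 : ∀ w, ‖w‖ ≤ 1 / 8 → ‖H w - H 0‖ ≤ 2 * M := by
    intro w hw
    refine (hBC w (by simp only [Metric.mem_ball, dist_zero_right]; linarith)).trans ?_
    rw [div_le_iff₀ (by linarith)]
    nlinarith
  have hsph : ∀ {w x : ℂ} {a b : ℝ}, ‖w‖ ≤ a → x ∈ Metric.closedBall w b → ‖x‖ ≤ a + b := by
    intro w x a b hw hx
    have h4 : ‖x - w‖ ≤ b := by simpa [dist_eq_norm] using hx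
    calc ‖x‖ = ‖w + (x - w)‖ := by ring_nf
      _ ≤ ‖w‖ + ‖x - w‖ := norm_add_le _ _
      _ ≤ a + b := add_le_add hw h4
  have hcl : ∀ w : ℂ, ‖w‖ ≤ 1 / 16 → Metric.closedBall w (1 / 32) ⊆ Metric.ball 0 1 := by
    intro w hw x hx
    simp only [Metric.mem_ball, dist_zero_right]
    linarith [hsph hw hx]
  have h4 : ∀ w, ‖w‖ ≤ 1 / 16 → ‖deriv H w‖ ≤ 64 * M := by
    intro w hw
    have h5 := Complex.norm_deriv_le_of_forall_mem_sphere_norm_le (f := fun z => H z - H 0)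
      (c := w) (R := 1 / 32) (C := 2 * M) (by norm_num)
      (DifferentiableOn.diffContOnCl (((hH.differentiableOn).mono
        (Metric.closure_ball_subset_closedBall.trans (hcl w hw))).sub_const _))
      (fun x hx => h3 x ((hsph hw (Metric.sphere_subset_closedBall hx)).trans (by norm_num)))
    rw [deriv_sub_const] at h5
    linarith
  have h6 : ‖deriv (deriv H) z‖ ≤ 2048 * M := by
    have h5 := Complex.norm_deriv_le_of_forall_mem_sphere_norm_le (f := deriv H)
      (c := z) (R := 1 / 32) (C := 64 * M) (by norm_num)
      (DifferentiableOn.diffContOnCl ((hH.deriv.differentiableOn).mono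
        (Metric.closure_ball_subset_closedBall.trans (hcl z (hz.trans (by norm_num))))))
      (fun x hx => h4 x ((hsph hz (Metric.sphere_subset_closedBall hx)).trans (by norm_num)))
    linarith
  exact ⟨(h4 z (hz.trans (by norm_num))).trans (by linarith), h6.trans (by linarith)⟩

/-- Let `f = zⁿ exp H` be holomorphic on the unit disc, take each positive imaginary value at most
`n` times and have no critical point with `Re f = 0` but the origin. Then the first two derivatives
of `H` near the origin are bounded in terms of `n` only. -/
theorem exists_bound_deriv_exponent (n : ℕ) : ∃ C : ℝ, 0 < C ∧ ∀ f H : ℂ → ℂ,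
    AnalyticOnNhd ℂ f (Metric.ball 0 1) → AnalyticOnNhd ℂ H (Metric.ball 0 1) → n ≠ 0 →
    (∀ z ∈ Metric.ball (0 : ℂ) 1, f z = z ^ n * Complex.exp (H z)) →
    (∀ z ∈ Metric.ball (0 : ℂ) 1, z ≠ 0 → (f z).re = 0 → deriv f z ≠ 0) →
    (∀ s : ℝ, 0 < s → ∀ T : Finset ℂ,
      (∀ z ∈ T, z ∈ Metric.ball (0 : ℂ) 1 ∧ f z = Complex.I * s) → T.card ≤ n) →
    ∀ z : ℂ, ‖z‖ ≤ 1 / 32 → ‖deriv H z‖ ≤ C ∧ ‖deriv (deriv H) z‖ ≤ C := by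
  -- `K` bounds the mean of `log⁺ |f₁|` for the radii `1/2` and `1/16`. In `A`, the `3` is the
  -- Poisson constant and `n log 2` is `-n log |x|` on `|x| = 1/2`.
  set K : ℝ := n * Real.log (1 / 2 / (1 / 16)) + 2 * Real.log 3 + Real.log 2 +
    ∫ s : ℝ, Real.posLog |s|⁻¹ with hK
  set A : ℝ := 3 * (K + n * Real.log 2) with hA
  refine ⟨max 1 (6144 * (A + 1)), by positivity, ?_⟩
  intro f H hf hH hn hfH hcrit hcard z hz
  have hsub : Metric.closedBall (0 : ℂ) (1 / 2) ⊆ Metric.ball 0 1 :=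
    Metric.closedBall_subset_ball (by norm_num)
  have hsub' : Metric.closedBall (0 : ℂ) (1 / 16) ⊆ Metric.ball 0 1 :=
    Metric.closedBall_subset_ball (by norm_num)
  -- Dividing by the maximum modulus makes `|f₁| ≤ 1` on the small disc with equality at `z₀`. The
  -- equality yields `Re H₁ z₀ = -n log |z₀| ≥ 0`.
  obtain ⟨z₀, hz₀, hmax⟩ := (isCompact_closedBall (0 : ℂ) (1 / 16)).exists_isMaxOn
    ⟨0, by simp⟩ (hf.mono hsub').continuousOn.norm
  set M := ‖f z₀‖ with hM
  have hMpos : 0 < M := by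
    have h1 : ((1 / 16 : ℝ) : ℂ) ∈ Metric.closedBall (0 : ℂ) (1 / 16) := by simp
    refine lt_of_lt_of_le (norm_pos_iff.2 ?_) (hmax h1)
    rw [hfH _ (hsub' h1)]
    exact mul_ne_zero (pow_ne_zero n (by norm_num)) (Complex.exp_ne_zero _)
  have hMc : (M : ℂ) ≠ 0 := by exact_mod_cast hMpos.ne'
  set f₁ : ℂ → ℂ := fun z => (M : ℂ)⁻¹ * f z with hf₁
  set H₁ : ℂ → ℂ := fun z => H z - Real.log M with hH₁
  have hf₁a : AnalyticOnNhd ℂ f₁ (Metric.ball 0 1) := fun z hz => analyticAt_const.mul (hf z hz)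
  have hH₁a : AnalyticOnNhd ℂ H₁ (Metric.ball 0 1) := fun z hz => (hH z hz).sub analyticAt_const
  have hf₁H : ∀ z ∈ Metric.ball (0 : ℂ) 1, f₁ z = z ^ n * Complex.exp (H₁ z) := by
    intro z hz
    rw [hf₁, hH₁]
    simp only
    rw [hfH z hz, Complex.exp_sub, ← Complex.ofReal_exp, Real.exp_log hMpos]
    field_simp
  have hdf₁ : ∀ z ∈ Metric.ball (0 : ℂ) 1, deriv f₁ z = (M : ℂ)⁻¹ * deriv f z := fun z hz =>
    deriv_const_mul _ (hf z hz).differentiableAt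
  have havg := circleAverage_posLog_le_of_card_le (f := f₁) (r := 1 / 2) (ρ := 1 / 16) (n := n)
    (by norm_num) (by norm_num) (by norm_num) (hf₁a.mono hsub)
    (by rw [hf₁H 0 (by simp), zero_pow hn, zero_mul])
    (fun w hw => by
      rw [hf₁, norm_mul, norm_inv, Complex.norm_real, Real.norm_of_nonneg hMpos.le,
        inv_mul_le_iff₀ hMpos, mul_one]
      exact hmax hw)
    (fun w hw hw0 hre => by
      rw [hdf₁ w (hsub hw)]
      refine mul_ne_zero (inv_ne_zero hMc) (hcrit w (hsub hw) hw0 ?_)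
      rw [hf₁, ← Complex.ofReal_inv, Complex.re_ofReal_mul] at hre
      exact (mul_eq_zero.1 hre).resolve_left (inv_ne_zero hMpos.ne'))
    (fun s hs T hT => hcard (M * s) (mul_pos hMpos hs) T fun w hw => by
      refine ⟨hsub (hT w hw).1, ?_⟩
      have h1 := (hT w hw).2
      rw [hf₁] at h1
      simp only at h1
      rw [inv_mul_eq_iff_eq_mul₀ hMc] at h1
      rw [h1]
      push_cast
      ring)
  have hi : CircleIntegrable (fun z => Real.posLog ‖f₁ z‖) 0 (1 / 2) := by
    refine MeromorphicOn.circleIntegrable_posLog_norm ?_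
    rw [abs_of_pos (by norm_num)]
    exact (hf₁a.mono (Metric.sphere_subset_closedBall.trans hsub)).meromorphicOn
  have hlognorm : ∀ w ∈ Metric.ball (0 : ℂ) 1, w ≠ 0 →
      Real.log ‖f₁ w‖ = n * Real.log ‖w‖ + (H₁ w).re := by
    intro w hw hw0
    rw [hf₁H w hw, norm_mul, norm_pow, Complex.norm_exp, Real.log_mul
      (pow_ne_zero n (norm_ne_zero_iff.2 hw0)) (Real.exp_ne_zero _), Real.log_pow, Real.log_exp]
  have hre : ∀ w ∈ Metric.ball (0 : ℂ) (1 / 4), (H₁ w).re ≤ A := by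
    intro w hw
    have h2 := re_le_three_mul_circleAverage (H := H₁) (r := 1 / 2)
      (B := fun z => Real.posLog ‖f₁ z‖ + n * Real.log 2) (hH₁a.mono hsub)
      (hi.add (circleIntegrable_const _ _ _))
      (fun z => add_nonneg Real.posLog_nonneg (by positivity))
      (fun x hx => by
        have hxn : ‖x‖ = 1 / 2 := by simpa using hx
        have h3 := hlognorm x (hsub (Metric.sphere_subset_closedBall hx))
          (norm_ne_zero_iff.1 (by rw [hxn]; norm_num))
        rw [hxn, one_div, Real.log_inv] at h3
        have h4 : Real.log ‖f₁ x‖ ≤ Real.posLog ‖f₁ x‖ := le_max_right _ _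
        linarith) (w := w) (by convert hw using 2; norm_num)
    rw [Real.circleAverage_fun_add hi (circleIntegrable_const _ _ _), Real.circleAverage_const]
      at h2
    linarith
  have hz₀f : ‖f₁ z₀‖ = 1 := by
    rw [hf₁, norm_mul, norm_inv, Complex.norm_real, Real.norm_of_nonneg hMpos.le, ← hM,
      inv_mul_cancel₀ hMpos.ne']
  have hz₀0 : z₀ ≠ 0 := by
    rintro rfl
    rw [hf₁H 0 (by simp), zero_pow hn, zero_mul, norm_zero] at hz₀f
    exact zero_ne_one hz₀f
  have hz₀re : 0 ≤ (H₁ z₀).re := by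
    have h1 := hlognorm z₀ (hsub' hz₀) hz₀0
    rw [hz₀f, Real.log_one] at h1
    have h2 : Real.log ‖z₀‖ ≤ 0 :=
      Real.log_nonpos (norm_nonneg _) ((by simpa using hz₀ : ‖z₀‖ ≤ 16⁻¹).trans (by norm_num))
    have h3 : (n : ℝ) * Real.log ‖z₀‖ ≤ 0 := mul_nonpos_of_nonneg_of_nonpos (Nat.cast_nonneg n) h2
    linarith
  have hfin := norm_deriv_le_of_re_le hH₁a hre ⟨z₀, hz₀, hz₀re⟩ hz
  have hdH : deriv H₁ = deriv H := by
    funext w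
    rw [hH₁, deriv_sub_const]
  rw [hdH] at hfin
  exact ⟨hfin.1.trans (le_max_right _ _), hfin.2.trans (le_max_right _ _)⟩

/-! ### Vanishing order and curvature in terms of `F` -/

theorem iteratedFDeriv_re_apply {F : ℂ → ℂ} {p : ℂ} (hF : AnalyticAt ℂ F p) (k : ℕ)
    (v : Fin k → ℂ) :
    iteratedFDeriv ℝ k (fun z => (F z).re) p v = ((∏ i, v i) * iteratedDeriv k F p).re := by
  have hc : ContDiffAt ℂ k F p := hF.contDiffAt
  have h1 := Complex.reCLM.iteratedFDeriv_comp_left (hc.restrict_scalars ℝ) (i := k) le_rfl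
  have h2 : (fun z => (F z).re) = Complex.reCLM ∘ F := rfl
  rw [h2, h1, ← hc.restrictScalars_iteratedFDeriv]
  simp [iteratedFDeriv_apply_eq_iteratedDeriv_mul_prod]

theorem iteratedFDeriv_re_eq_zero_iff {F : ℂ → ℂ} {p : ℂ} (hF : AnalyticAt ℂ F p) {k : ℕ}
    (hk : k ≠ 0) :
    iteratedFDeriv ℝ k (fun z => (F z).re) p = 0 ↔ iteratedDeriv k F p = 0 := by
  constructor
  · intro h
    -- With `D` the `k`-th complex derivative, the test vector `(D̄, 1, …, 1)` gives `Re (D̄ D) =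
    -- |D|²`.
    have h1 := iteratedFDeriv_re_apply hF k fun i =>
      if i = ⟨0, Nat.pos_of_ne_zero hk⟩ then (starRingEnd ℂ) (iteratedDeriv k F p) else 1
    rw [h, Finset.prod_ite_eq' Finset.univ, if_pos (Finset.mem_univ _)] at h1
    simp only [zero_apply, mul_comm ((starRingEnd ℂ) _),
      Complex.mul_conj, Complex.ofReal_re] at h1
    exact Complex.normSq_eq_zero.1 h1.symm
  · intro h
    ext v
    rw [iteratedFDeriv_re_apply hF, h]
    simp

theorem analyticOrderAt_eq_of_hasVanishingOrder {F : ℂ → ℂ} {p : ℂ} (hF : AnalyticAt ℂ F p)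
    (hp : F p = 0) {n : ℕ} (hord : HasVanishingOrder (fun z => (F z).re) p n) :
    n ≠ 0 ∧ analyticOrderAt F p = n := by
  have hn : n ≠ 0 := by
    rintro rfl
    refine hord.2 ?_
    ext v
    simp [hp]
  refine ⟨hn, (analyticOrderAt_eq_nat_iff_iteratedDeriv_eq_zero hF).2 ⟨fun k hk => ?_, fun h => ?_⟩⟩
  · rcases eq_or_ne k 0 with rfl | hk0
    · simpa using hp
    · exact (iteratedFDeriv_re_eq_zero_iff hF hk0).1 (hord.1 k hk)
  · exact hord.2 ((iteratedFDeriv_re_eq_zero_iff hF hn).2 h)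

/-- The curvature of a level curve of `Re F`. The real multiple of `F' / F` may be subtracted
because `F` is imaginary along the curve. -/
theorem abs_signedCurvature_le {F : ℂ → ℂ} {R : ℝ} (hF : AnalyticOnNhd ℂ F (Metric.ball 0 R))
    {γ : ℝ → ℂ} (hγ : IsRegularAnalyticCurveIn (fun z => (F z).re) (Metric.ball 0 R) γ) {t : ℝ}
    (h0 : F (γ t) ≠ 0) (h1 : deriv F (γ t) ≠ 0) (l : ℝ) :
    |signedCurvature γ t| ≤
      ‖deriv (deriv F) (γ t) / deriv F (γ t) - l * (deriv F (γ t) / F (γ t))‖ := by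
  have hd1 : ∀ t, HasDerivAt (fun t => F (γ t)) (deriv F (γ t) * deriv γ t) t := fun t =>
    (hF _ (hγ.mem t).1).differentiableAt.hasDerivAt.comp t (hγ.hasDerivAt t)
  have hdF : HasDerivAt (fun t => deriv F (γ t)) (deriv (deriv F) (γ t) * deriv γ t) t :=
    (hF _ (hγ.mem t).1).deriv.differentiableAt.hasDerivAt.comp t (hγ.hasDerivAt t)
  have hd2 : HasDerivAt (fun t => deriv F (γ t) * deriv γ t)
      (deriv (deriv F) (γ t) * deriv γ t * deriv γ t + deriv F (γ t) * deriv (deriv γ) t) t :=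
    hdF.mul (hγ.analytic t (mem_univ t)).deriv.differentiableAt.hasDerivAt
  have hre : ∀ (g : ℝ → ℂ) (g' : ℂ) (s : ℝ), (∀ t, (g t).re = 0) → HasDerivAt g g' s →
      g'.re = 0 := by
    intro g g' s hg hgd
    have h2 := Complex.reCLM.hasFDerivAt.comp_hasDerivAt s hgd
    have h3 : (Complex.reCLM ∘ g) = fun _ => 0 := funext hg
    rw [h3] at h2
    exact h2.unique (hasDerivAt_const s 0)
  have r0 : ∀ t, (F (γ t)).re = 0 := fun t => (hγ.mem t).2
  have r1 : ∀ t, (deriv F (γ t) * deriv γ t).re = 0 := fun t => hre _ _ t r0 (hd1 t)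
  have r2 := hre _ _ t r1 hd2
  have hγ' := hγ.regular t
  set a := deriv γ t with ha
  set b := deriv (deriv γ) t with hb
  set f0 := F (γ t)
  set f1 := deriv F (γ t)
  set f2 := deriv (deriv F) (γ t)
  have hquot : ∀ {x y : ℂ}, x.re = 0 → y.re = 0 → (x / y).im = 0 := by
    intro x y hx hy
    rw [Complex.div_im, hx, hy]
    simp
  have q1 : (f1 * a / f0).im = 0 := hquot (r1 t) (r0 t)
  have q2 : ((f2 * a * a + f1 * b) / (f1 * a)).im = 0 := hquot r2 (r1 t)
  -- The curvature is `Im (γ''/γ') / |γ'|`. The first two terms on the right are real, being real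
  -- multiples of quotients of imaginary numbers, so only the last one contributes.
  have e1 : b / a = (f2 * a * a + f1 * b) / (f1 * a) - l * (f1 * a / f0)
      - (f2 / f1 - l * (f1 / f0)) * a := by
    field_simp
    ring
  have e2 : (b / a).im = -((f2 / f1 - l * (f1 / f0)) * a).im := by
    rw [e1, Complex.sub_im, Complex.sub_im, q2, Complex.im_ofReal_mul, q1]
    simp
  have e3 : a.re * b.im - a.im * b.re = ‖a‖ ^ 2 * (b / a).im := by
    rw [Complex.div_im, ← Complex.normSq_eq_norm_sq]
    have : Complex.normSq a ≠ 0 := (Complex.normSq_pos.2 hγ').ne'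
    field_simp
  have hapos : 0 < ‖a‖ := norm_pos_iff.2 hγ'
  rw [signedCurvature, ← ha, ← hb, e3, e2, abs_div, abs_mul, abs_of_pos (pow_pos hapos 2),
    abs_of_pos (pow_pos hapos 3), abs_neg, div_le_iff₀ (pow_pos hapos 3)]
  have h4 := Complex.abs_im_le_norm ((f2 / f1 - l * (f1 / f0)) * a)
  rw [norm_mul] at h4
  calc ‖a‖ ^ 2 * |((f2 / f1 - l * (f1 / f0)) * a).im|
      ≤ ‖a‖ ^ 2 * (‖f2 / f1 - l * (f1 / f0)‖ * ‖a‖) := by gcongr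
    _ = _ := by ring

/-! ### The Möbius map and its derivatives -/

/-- The inverse of `discMobius`. -/
noncomputable def discMobiusInv (r₀ : ℝ) (p : ℂ) (α : ℝ) (w : ℂ) : ℂ :=
  r₀ * (r₀ * (w / Complex.exp (α * Complex.I)) + p) /
    (r₀ + (starRingEnd ℂ) p * (w / Complex.exp (α * Complex.I)))

section Mobius

variable {r₀ : ℝ} {p : ℂ} {α : ℝ}

theorem norm_exp_mul_I_eq_one (α : ℝ) : ‖Complex.exp (α * Complex.I)‖ = 1 :=
  Complex.norm_exp_ofReal_mul_I α

theorem discMobius_denom_ne_zero (hp : ‖p‖ < r₀) {z : ℂ} (hz : ‖z‖ < r₀) :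
    (r₀ : ℂ) ^ 2 - (starRingEnd ℂ) p * z ≠ 0 := by
  intro h
  have h1 : (r₀ : ℂ) ^ 2 = (starRingEnd ℂ) p * z := sub_eq_zero.1 h
  have h2 := congrArg norm h1
  rw [norm_mul, RCLike.norm_conj, norm_pow, Complex.norm_real, Real.norm_eq_abs, sq_abs] at h2
  nlinarith [norm_nonneg p, norm_nonneg z]

theorem discMobiusInv_denom_ne_zero (hp : ‖p‖ < r₀) {w : ℂ} (hw : ‖w‖ < 1) :
    (r₀ : ℂ) + (starRingEnd ℂ) p * w ≠ 0 := by
  intro h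
  have h1 : (r₀ : ℂ) = -((starRingEnd ℂ) p * w) := eq_neg_of_add_eq_zero_left h
  have h2 := congrArg norm h1
  rw [norm_neg, norm_mul, RCLike.norm_conj, Complex.norm_real, Real.norm_eq_abs] at h2
  nlinarith [norm_nonneg p, norm_nonneg w, le_abs_self r₀]

theorem norm_discMobiusInv_lt (hp : ‖p‖ < r₀) {w : ℂ} (hw : ‖w‖ < 1) :
    ‖discMobiusInv r₀ p α w‖ < r₀ := by
  have hr : 0 < r₀ := (norm_nonneg p).trans_lt hp
  set v := w / Complex.exp (α * Complex.I) with hv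
  have hvn : ‖v‖ < 1 := by rwa [hv, norm_div, norm_exp_mul_I_eq_one, div_one]
  have hd := norm_pos_iff.2 (discMobiusInv_denom_ne_zero hp hvn)
  rw [discMobiusInv, ← hv, norm_div, norm_mul, Complex.norm_real, Real.norm_of_nonneg hr.le,
    div_lt_iff₀ hd]
  refine mul_lt_mul_of_pos_left (lt_of_pow_lt_pow_left₀ 2 hd.le ?_) hr
  have h1 : ‖(r₀ : ℂ) + (starRingEnd ℂ) p * v‖ ^ 2 - ‖r₀ * v + p‖ ^ 2 =
      (r₀ ^ 2 - ‖p‖ ^ 2) * (1 - ‖v‖ ^ 2) := by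
    simp only [← Complex.normSq_eq_norm_sq, Complex.normSq_apply]
    simp
    ring
  have h2 : 0 < (r₀ ^ 2 - ‖p‖ ^ 2) * (1 - ‖v‖ ^ 2) := by
    refine mul_pos ?_ ?_
    · nlinarith [norm_nonneg p]
    · nlinarith [norm_nonneg v]
  linarith

theorem discMobius_discMobiusInv (hp : ‖p‖ < r₀) {w : ℂ} (hw : ‖w‖ < 1) :
    discMobius r₀ p α (discMobiusInv r₀ p α w) = w := by
  have hr : 0 < r₀ := (norm_nonneg p).trans_lt hp
  have hz := discMobius_denom_ne_zero hp (norm_discMobiusInv_lt (α := α) hp hw)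
  have hE := Complex.exp_ne_zero (α * Complex.I)
  rw [discMobius, ← mul_div_assoc, div_eq_iff hz]
  rw [discMobiusInv]
  set v := w / Complex.exp (α * Complex.I) with hv
  have hvn : ‖v‖ < 1 := by rwa [hv, norm_div, norm_exp_mul_I_eq_one, div_one]
  have hd := discMobiusInv_denom_ne_zero hp hvn
  have hw' : w = v * Complex.exp (α * Complex.I) := by rw [hv]; field_simp
  rw [hw']
  obtain ⟨d, hd'⟩ : ∃ d, d = (r₀ : ℂ) + (starRingEnd ℂ) p * v := ⟨_, rfl⟩
  rw [← hd'] at hd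
  rw [← hd']
  field_simp
  rw [hd']
  ring

theorem discMobiusInv_discMobius (hp : ‖p‖ < r₀) {z : ℂ} (hz : ‖z‖ < r₀) :
    discMobiusInv r₀ p α (discMobius r₀ p α z) = z := by
  have hr : 0 < r₀ := (norm_nonneg p).trans_lt hp
  have hz' := discMobius_denom_ne_zero hp hz
  have hpp := discMobius_denom_ne_zero hp hp
  have hE := Complex.exp_ne_zero (α * Complex.I)
  have hrc : (r₀ : ℂ) ≠ 0 := by exact_mod_cast hr.ne'
  rw [discMobiusInv, discMobius, mul_div_cancel_left₀ _ hE]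
  have hd : (r₀ : ℂ) + (starRingEnd ℂ) p * (r₀ * (z - p) / (r₀ ^ 2 - (starRingEnd ℂ) p * z)) =
      r₀ * (r₀ ^ 2 - (starRingEnd ℂ) p * p) / (r₀ ^ 2 - (starRingEnd ℂ) p * z) := by
    field_simp
    ring
  rw [hd, div_eq_iff (div_ne_zero (mul_ne_zero hrc hpp) hz')]
  obtain ⟨d, hd'⟩ : ∃ d, d = (r₀ : ℂ) ^ 2 - (starRingEnd ℂ) p * z := ⟨_, rfl⟩
  rw [← hd'] at hz'
  rw [← hd']
  field_simp
  rw [hd']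
  ring

theorem analyticAt_discMobiusInv (hp : ‖p‖ < r₀) {w : ℂ} (hw : ‖w‖ < 1) :
    AnalyticAt ℂ (discMobiusInv r₀ p α) w := by
  have hvn : ‖w / Complex.exp (α * Complex.I)‖ < 1 := by
    rwa [norm_div, norm_exp_mul_I_eq_one, div_one]
  have hd := discMobiusInv_denom_ne_zero hp hvn
  have hE := Complex.exp_ne_zero (α * Complex.I)
  have h1 : AnalyticAt ℂ (fun w : ℂ => w / Complex.exp (α * Complex.I)) w :=
    analyticAt_id.div analyticAt_const hE
  exact (analyticAt_const.mul ((analyticAt_const.mul h1).add analyticAt_const)).div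
    (analyticAt_const.add (analyticAt_const.mul h1)) hd

theorem hasDerivAt_discMobius (hp : ‖p‖ < r₀) {z : ℂ} (hz : ‖z‖ < r₀) :
    HasDerivAt (discMobius r₀ p α) (Complex.exp (α * Complex.I) * r₀ *
      (r₀ ^ 2 - (starRingEnd ℂ) p * p) / (r₀ ^ 2 - (starRingEnd ℂ) p * z) ^ 2) z := by
  have hz' := discMobius_denom_ne_zero hp hz
  have h1 : HasDerivAt (fun z : ℂ => (r₀ : ℂ) ^ 2 - (starRingEnd ℂ) p * z)
      (-((starRingEnd ℂ) p * 1)) z := ((hasDerivAt_id z).const_mul _).const_sub _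
  have h2 : HasDerivAt (fun z : ℂ => (r₀ : ℂ) * (z - p)) (r₀ * 1) z :=
    ((hasDerivAt_id z).sub_const p).const_mul _
  have h3 : HasDerivAt (discMobius r₀ p α) _ z := (h2.div h1 hz').const_mul _
  convert h3 using 1
  field_simp
  ring

theorem hasDerivAt_deriv_discMobius (hp : ‖p‖ < r₀) {z : ℂ} (hz : ‖z‖ < r₀) :
    HasDerivAt (deriv (discMobius r₀ p α)) (deriv (discMobius r₀ p α) z *
      (2 * (starRingEnd ℂ) p / (r₀ ^ 2 - (starRingEnd ℂ) p * z))) z := by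
  have hz' := discMobius_denom_ne_zero hp hz
  have h1 : HasDerivAt (fun z : ℂ => (r₀ : ℂ) ^ 2 - (starRingEnd ℂ) p * z)
      (-((starRingEnd ℂ) p * 1)) z := ((hasDerivAt_id z).const_mul _).const_sub _
  have h2 : HasDerivAt (fun z : ℂ => Complex.exp (α * Complex.I) * r₀ *
      (r₀ ^ 2 - (starRingEnd ℂ) p * p) / (r₀ ^ 2 - (starRingEnd ℂ) p * z) ^ 2) _ z :=
    (hasDerivAt_const z _).div (h1.pow 2) (pow_ne_zero 2 hz')
  have h3 : deriv (discMobius r₀ p α) =ᶠ[𝓝 z] fun z : ℂ => Complex.exp (α * Complex.I) * r₀ *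
      (r₀ ^ 2 - (starRingEnd ℂ) p * p) / (r₀ ^ 2 - (starRingEnd ℂ) p * z) ^ 2 := by
    filter_upwards [(isOpen_lt continuous_norm continuous_const).mem_nhds hz] with w hw
    exact (hasDerivAt_discMobius hp hw).deriv
  refine HasDerivAt.congr_of_eventuallyEq ?_ h3
  rw [(hasDerivAt_discMobius hp hz).deriv]
  refine h2.congr_deriv ?_
  obtain ⟨d, hd'⟩ : ∃ d, d = (r₀ : ℂ) ^ 2 - (starRingEnd ℂ) p * z := ⟨_, rfl⟩
  rw [← hd'] at hz'
  simp only [← hd']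
  field_simp
  ring

theorem deriv_discMobius_ne_zero (hp : ‖p‖ < r₀) {z : ℂ} (hz : ‖z‖ < r₀) :
    deriv (discMobius r₀ p α) z ≠ 0 := by
  have hr : 0 < r₀ := (norm_nonneg p).trans_lt hp
  rw [(hasDerivAt_discMobius hp hz).deriv]
  exact div_ne_zero (mul_ne_zero (mul_ne_zero (Complex.exp_ne_zero _)
    (by exact_mod_cast hr.ne')) (discMobius_denom_ne_zero hp hp))
    (pow_ne_zero 2 (discMobius_denom_ne_zero hp hz))

/-- With `d` the denominator and `v = r₀ (z - p) / d`, one has `d (r₀ + p̄ v) = r₀ (r₀² - |p|²)`,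
and `|r₀ + p̄ v| ≤ 2 r₀` because `|v| ≤ 1`. -/
theorem norm_inv_discMobius_denom_le (hp : ‖p‖ < r₀) {z : ℂ} (hz : ‖z‖ < r₀)
    (hψ : ‖discMobius r₀ p α z‖ ≤ 1) :
    ‖(r₀ : ℂ) ^ 2 - (starRingEnd ℂ) p * z‖⁻¹ ≤ 2 / (r₀ ^ 2 - ‖p‖ ^ 2) := by
  have hr : 0 < r₀ := (norm_nonneg p).trans_lt hp
  have hS : 0 < r₀ ^ 2 - ‖p‖ ^ 2 := by nlinarith [norm_nonneg p]
  have hz' := discMobius_denom_ne_zero hp hz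
  set d := (r₀ : ℂ) ^ 2 - (starRingEnd ℂ) p * z with hd
  set v := r₀ * (z - p) / d with hv
  have hvn : ‖v‖ ≤ 1 := by
    rw [discMobius, norm_mul, norm_exp_mul_I_eq_one, one_mul] at hψ
    exact hψ
  have h1 : d * (r₀ + (starRingEnd ℂ) p * v) = r₀ * ((r₀ ^ 2 - ‖p‖ ^ 2 : ℝ) : ℂ) := by
    have h2 : ((‖p‖ ^ 2 : ℝ) : ℂ) = (starRingEnd ℂ) p * p := by
      rw [mul_comm, Complex.mul_conj, Complex.normSq_eq_norm_sq]
    push_cast at h2 ⊢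
    rw [h2, hv]
    field_simp
    rw [hd]
    ring
  have h3 := congrArg norm h1
  rw [norm_mul, norm_mul, Complex.norm_real, Complex.norm_real, Real.norm_of_nonneg hr.le,
    Real.norm_of_nonneg hS.le] at h3
  have h4 : ‖(r₀ : ℂ) + (starRingEnd ℂ) p * v‖ ≤ 2 * r₀ := by
    refine (norm_add_le _ _).trans ?_
    rw [norm_mul, RCLike.norm_conj, Complex.norm_real, Real.norm_of_nonneg hr.le]
    nlinarith [norm_nonneg p, norm_nonneg v]
  have hdpos : 0 < ‖d‖ := norm_pos_iff.2 hz'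
  have h5 : r₀ * (r₀ ^ 2 - ‖p‖ ^ 2) ≤ r₀ * (2 * ‖d‖) := by
    rw [← h3]
    nlinarith
  have h6 : r₀ ^ 2 - ‖p‖ ^ 2 ≤ 2 * ‖d‖ := le_of_mul_le_mul_left h5 hr
  rw [inv_eq_one_div, div_le_div_iff₀ hdpos hS]
  linarith

theorem norm_deriv_discMobius_le (hp : ‖p‖ < r₀) {z : ℂ} (hz : ‖z‖ < r₀)
    (hψ : ‖discMobius r₀ p α z‖ ≤ 1) :
    ‖deriv (discMobius r₀ p α) z‖ ≤ 4 * r₀ / (r₀ ^ 2 - ‖p‖ ^ 2) := by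
  have hr : 0 < r₀ := (norm_nonneg p).trans_lt hp
  have hS : 0 < r₀ ^ 2 - ‖p‖ ^ 2 := by nlinarith [norm_nonneg p]
  have h2 : (r₀ : ℂ) ^ 2 - (starRingEnd ℂ) p * p = ((r₀ ^ 2 - ‖p‖ ^ 2 : ℝ) : ℂ) := by
    have : ((‖p‖ ^ 2 : ℝ) : ℂ) = (starRingEnd ℂ) p * p := by
      rw [mul_comm, Complex.mul_conj, Complex.normSq_eq_norm_sq]
    push_cast at this ⊢
    rw [this]
  rw [(hasDerivAt_discMobius hp hz).deriv, h2, norm_div, norm_mul, norm_mul,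
    norm_exp_mul_I_eq_one, one_mul, Complex.norm_real, Complex.norm_real,
    Real.norm_of_nonneg hr.le, Real.norm_of_nonneg hS.le, norm_pow, div_eq_mul_inv, ← inv_pow]
  calc r₀ * (r₀ ^ 2 - ‖p‖ ^ 2) * (‖(r₀ : ℂ) ^ 2 - (starRingEnd ℂ) p * z‖⁻¹) ^ 2
      ≤ r₀ * (r₀ ^ 2 - ‖p‖ ^ 2) * (2 / (r₀ ^ 2 - ‖p‖ ^ 2)) ^ 2 := by
        gcongr
        exact norm_inv_discMobius_denom_le hp hz hψ
    _ = 4 * r₀ / (r₀ ^ 2 - ‖p‖ ^ 2) := by field_simp; ring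

theorem norm_two_mul_conj_div_le (hp : ‖p‖ < r₀) {z : ℂ} (hz : ‖z‖ < r₀)
    (hψ : ‖discMobius r₀ p α z‖ ≤ 1) :
    ‖2 * (starRingEnd ℂ) p / (r₀ ^ 2 - (starRingEnd ℂ) p * z)‖ ≤
      4 * r₀ / (r₀ ^ 2 - ‖p‖ ^ 2) := by
  have hr : 0 < r₀ := (norm_nonneg p).trans_lt hp
  rw [norm_div, norm_mul, RCLike.norm_conj, RCLike.norm_ofNat, div_eq_mul_inv]
  calc 2 * ‖p‖ * ‖(r₀ : ℂ) ^ 2 - (starRingEnd ℂ) p * z‖⁻¹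
      ≤ 2 * r₀ * (2 / (r₀ ^ 2 - ‖p‖ ^ 2)) := by
        gcongr
        exact norm_inv_discMobius_denom_le hp hz hψ
    _ = 4 * r₀ / (r₀ ^ 2 - ‖p‖ ^ 2) := by ring

end Mobius

/-! ### Cancellation of poles and the final estimate -/

/-- At the origin `f''/f'` and `f'/f` have simple poles with residues `n - 1` and `n`, so the weight
`(n - 1)/n` cancels them. What is left is `H'/n + (H' + w H'') / (n + w H')`, whose last denominator
has modulus at least `1/2` by `hwC`. -/
theorem norm_pow_mul_exp_quotient_le {f H : ℂ → ℂ} {n : ℕ} (hn : n ≠ 0)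
    (hH : AnalyticOnNhd ℂ H (Metric.ball 0 1))
    (hf : ∀ z ∈ Metric.ball (0 : ℂ) 1, f z = z ^ n * Complex.exp (H z)) {w : ℂ} (hw0 : w ≠ 0)
    (hw : w ∈ Metric.ball (0 : ℂ) 1) {C : ℝ} (h1 : ‖deriv H w‖ ≤ C)
    (h2 : ‖deriv (deriv H) w‖ ≤ C) (hwC : ‖w‖ * C ≤ 1 / 2) :
    ‖deriv (deriv f) w / deriv f w - (((n - 1) / n : ℝ) : ℂ) * (deriv f w / f w)‖ ≤ 5 * C := by
  have hnc : (n : ℂ) ≠ 0 := by exact_mod_cast hn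
  have hn1 : (1 : ℝ) ≤ n := by exact_mod_cast Nat.one_le_iff_ne_zero.2 hn
  have hfw : f w ≠ 0 := by
    rw [hf w hw]
    exact mul_ne_zero (pow_ne_zero n hw0) (Complex.exp_ne_zero _)
  have hd : ∀ z ∈ Metric.ball (0 : ℂ) 1, z ≠ 0 →
      HasDerivAt f (f z * (n / z + deriv H z)) z := by
    intro z hz hz0
    have e : f =ᶠ[𝓝 z] fun z => z ^ n * Complex.exp (H z) := by
      filter_upwards [Metric.isOpen_ball.mem_nhds hz] with y hy using hf y hy
    refine HasDerivAt.congr_of_eventuallyEq ?_ e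
    have h3 := (hasDerivAt_pow n z).mul (hH z hz).differentiableAt.hasDerivAt.cexp
    refine h3.congr_deriv ?_
    rw [hf z hz]
    obtain ⟨k, rfl⟩ := Nat.exists_eq_succ_of_ne_zero hn
    simp only [Nat.succ_eq_add_one, Nat.add_sub_cancel, pow_succ]
    field_simp
  have hdw := hd w hw hw0
  have hL : HasDerivAt (fun z : ℂ => (n : ℂ) / z + deriv H z)
      (-n / w ^ 2 + deriv (deriv H) w) w := by
    have h3 := ((hasDerivAt_inv hw0).const_mul (n : ℂ)).add
      (hH w hw).deriv.differentiableAt.hasDerivAt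
    refine (h3.congr_deriv ?_)
    ring
  have hdd : deriv (deriv f) w = f w * (n / w + deriv H w) * (n / w + deriv H w) +
      f w * (-n / w ^ 2 + deriv (deriv H) w) := by
    have e : deriv f =ᶠ[𝓝 w] fun z => f z * (n / z + deriv H z) := by
      filter_upwards [Metric.isOpen_ball.mem_nhds hw, isOpen_ne.mem_nhds hw0] with y hy hy0
      exact (hd y hy hy0).deriv
    rw [e.deriv_eq]
    exact (hdw.mul hL).deriv
  rw [hdd, hdw.deriv]
  set m := deriv H w
  set m' := deriv (deriv H) w
  have hC : 0 ≤ C := (norm_nonneg _).trans h1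
  have hw1 : ‖w‖ < 1 := by simpa using hw
  have hD : 1 / 2 ≤ ‖(n : ℂ) + w * m‖ := by
    have h3 : ‖(n : ℂ)‖ ≤ ‖(n : ℂ) + w * m‖ + ‖w * m‖ := by
      simpa using norm_sub_le ((n : ℂ) + w * m) (w * m)
    rw [norm_mul, Complex.norm_natCast] at h3
    have h4 : ‖w‖ * ‖m‖ ≤ ‖w‖ * C := by gcongr
    linarith
  have hD0 : (n : ℂ) + w * m ≠ 0 := norm_pos_iff.1 (by linarith)
  have hL0 : (n : ℂ) / w + m ≠ 0 := by
    have : (n : ℂ) / w + m = ((n : ℂ) + w * m) / w := by field_simp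
    rw [this]
    exact div_ne_zero hD0 hw0
  have key : (f w * (n / w + m) * (n / w + m) + f w * (-n / w ^ 2 + m')) /
      (f w * (n / w + m)) - (((n - 1) / n : ℝ) : ℂ) * (f w * (n / w + m) / f w) =
      m / n + (m + w * m') / (n + w * m) := by
    have h3 : (n : ℂ) / w + m = ((n : ℂ) + w * m) / w := by field_simp
    push_cast
    rw [h3]
    field_simp
    ring
  rw [key]
  calc ‖m / n + (m + w * m') / (n + w * m)‖ ≤ ‖m‖ / n + (‖m‖ + ‖w‖ * ‖m'‖) / ‖n + w * m‖ := by
        refine (norm_add_le _ _).trans ?_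
        rw [norm_div, norm_div, Complex.norm_natCast]
        gcongr
        refine (norm_add_le _ _).trans ?_
        rw [norm_mul]
    _ ≤ C / 1 + (C + 1 * C) / (1 / 2) := by gcongr
    _ = 5 * C := by ring

/-- The quotient `F''/F'` transforms like a connection, with the extra term `ψ''/ψ'`, while `F'/F`
is only multiplied by `ψ'`. -/
theorem quotient_comp {f ψ F : ℂ → ℂ} {z : ℂ} (hf : AnalyticAt ℂ f (ψ z))
    (hψ : AnalyticAt ℂ ψ z) (hF : F =ᶠ[𝓝 z] f ∘ ψ) (h0 : deriv f (ψ z) ≠ 0)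
    (h1 : deriv ψ z ≠ 0) (l : ℂ) :
    deriv (deriv F) z / deriv F z - l * (deriv F z / F z) =
      deriv (deriv ψ) z / deriv ψ z + deriv ψ z *
        (deriv (deriv f) (ψ z) / deriv f (ψ z) - l * (deriv f (ψ z) / f (ψ z))) := by
  have hd : deriv F =ᶠ[𝓝 z] fun y => deriv f (ψ y) * deriv ψ y := by
    filter_upwards [hF.eventuallyEq_nhds, hψ.eventually_analyticAt,
      hψ.continuousAt.eventually hf.eventually_analyticAt] with y hy hψy hfy
    rw [hy.deriv_eq]
    exact deriv_comp y hfy.differentiableAt hψy.differentiableAt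
  have hdd : deriv (deriv F) z = deriv (deriv f) (ψ z) * deriv ψ z * deriv ψ z +
      deriv f (ψ z) * deriv (deriv ψ) z := by
    rw [hd.deriv_eq]
    exact ((hf.deriv.differentiableAt.hasDerivAt.comp z
      hψ.differentiableAt.hasDerivAt).mul hψ.deriv.differentiableAt.hasDerivAt).deriv
  rw [hdd, hd.eq_of_nhds, hF.eq_of_nhds]
  simp only [Function.comp_apply]
  field_simp
  ring

theorem nodalSet_congr {u v : ℂ → ℝ} {D : Set ℂ} (h : D.EqOn u v) : nodalSet u D = nodalSet v D := by
  ext z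
  exact and_congr_right fun hz => by rw [h hz]

theorem IsRegularAnalyticCurveIn.congr {u v : ℂ → ℝ} {D : Set ℂ} {γ : ℝ → ℂ}
    (hγ : IsRegularAnalyticCurveIn u D γ) (h : D.EqOn u v) : IsRegularAnalyticCurveIn v D γ :=
  ⟨hγ.analytic, hγ.regular, nodalSet_congr h ▸ hγ.subset_nodalSet⟩

theorem hasVanishingOrder_congr {u v : ℂ → ℝ} {p : ℂ} {n : ℕ} (h : u =ᶠ[𝓝 p] v)
    (hu : HasVanishingOrder u p n) : HasVanishingOrder v p n := by
  have e : ∀ k, iteratedFDeriv ℝ k u p = iteratedFDeriv ℝ k v p := fun k =>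
    (EventuallyEq.iteratedFDeriv ℝ h k).eq_of_nhds
  exact ⟨fun k hk => (e k).symm.trans (hu.1 k hk), fun h0 => hu.2 ((e n).trans h0)⟩

/-- A harmonic function on a disc vanishing at `p` is the real part of a holomorphic function
vanishing at `p`. -/
theorem exists_analyticOnNhd_re_eq_of_harmonicOnNhd {u : ℂ → ℝ} {R : ℝ} {p : ℂ}
    (hu : InnerProductSpace.HarmonicOnNhd u (Metric.ball 0 R)) (hp : p ∈ Metric.ball (0 : ℂ) R)
    (hup : u p = 0) :
    ∃ F : ℂ → ℂ, AnalyticOnNhd ℂ F (Metric.ball 0 R) ∧ F p = 0 ∧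
      (Metric.ball 0 R).EqOn u fun z => (F z).re := by
  obtain ⟨F, hF, hre⟩ := hu.exists_analyticOnNhd_ball_re_eq
  refine ⟨fun z => F z - F p, hF.sub analyticOnNhd_const, sub_self _, fun z hz => ?_⟩
  have h1 := hre hz
  have h2 := hre hp
  simp only at h1 h2
  simp [h1, h2, hup]

theorem exists_bound_signedCurvature (n : ℕ) :
    ∃ c C : ℝ, 0 < c ∧ c < 1 ∧ 0 < C ∧ ∀ (r₀ : ℝ) (F : ℂ → ℂ) (p : ℂ) (α : ℝ),
      AnalyticOnNhd ℂ F (Metric.ball 0 r₀) →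
      (¬ ∃ a : ℝ, ∀ z ∈ Metric.ball (0 : ℂ) r₀, (F z).re = a) →
      p ∈ Metric.ball (0 : ℂ) r₀ → F p = 0 → n ≠ 0 → analyticOrderAt F p = n →
      (∀ z ∈ nodalSet (fun z => (F z).re) (Metric.ball 0 r₀), ∃ γ,
        IsRegularAnalyticCurveIn (fun z => (F z).re) (Metric.ball 0 r₀) γ ∧
          z ∈ range γ ∧ p ∈ range γ) →
      ∀ γ : ℝ → ℂ, IsRegularAnalyticCurveIn (fun z => (F z).re) (Metric.ball 0 r₀) γ →
        ∀ t, γ t ≠ p → ‖discMobius r₀ p α (γ t)‖ < c →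
          |signedCurvature γ t| ≤ C * r₀ / (r₀ ^ 2 - ‖p‖ ^ 2) := by
  obtain ⟨C, hC, hbound⟩ := exists_bound_deriv_exponent n
  -- The radius `1/32` is where the bounds on `H` hold, and `1/(2C)` ensures `|w| C ≤ 1/2`. In `4 +
  -- 20 C`, the `4` comes from `ψ''/ψ'` and `20 C` from `ψ'` times the bound `5 C`.
  refine ⟨min (1 / 32) (1 / (2 * C)), 4 + 20 * C, by positivity,
    (min_le_left _ _).trans_lt (by norm_num), by positivity, ?_⟩
  intro r₀ F p α hF hnc hp hFp hn hord hcov γ hγ t htp hψt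
  have hpn : ‖p‖ < r₀ := by simpa using hp
  have hr : 0 < r₀ := (norm_nonneg p).trans_lt hpn
  have hS : 0 < r₀ ^ 2 - ‖p‖ ^ 2 := by nlinarith [norm_nonneg p]
  set φ := discMobiusInv r₀ p α with hφ
  set ψ := discMobius r₀ p α with hψ
  have hφψ : ∀ z, ‖z‖ < r₀ → φ (ψ z) = z := fun z hz => discMobiusInv_discMobius hpn hz
  have hψφ : ∀ w, ‖w‖ < 1 → ψ (φ w) = w := fun w hw => discMobius_discMobiusInv hpn hw
  have hφlt : ∀ w, ‖w‖ < 1 → ‖φ w‖ < r₀ := fun w hw => norm_discMobiusInv_lt hpn hw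
  have hφan : ∀ w, ‖w‖ < 1 → AnalyticAt ℂ φ w := fun w hw => analyticAt_discMobiusInv hpn hw
  have hψp : ψ p = 0 := by simp [hψ, discMobius]
  have hφ0 : φ 0 = p := by rw [← hψp, hφψ p hpn]
  have hφinj : InjOn φ (Metric.ball 0 1) := fun a ha b hb hab => by
    rw [← hψφ a (by simpa using ha), ← hψφ b (by simpa using hb), hab]
  have hφd : ∀ w, ‖w‖ < 1 → deriv φ w ≠ 0 := by
    intro w hw h0
    have h1 := (hasDerivAt_discMobius (α := α) hpn (hφlt w hw)).comp w
      (hφan w hw).differentiableAt.hasDerivAt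
    have h2 : ψ ∘ φ =ᶠ[𝓝 w] id := by
      filter_upwards [(isOpen_lt continuous_norm continuous_const).mem_nhds hw] with y hy
      exact hψφ y hy
    rw [h0, mul_zero] at h1
    exact one_ne_zero ((hasDerivAt_id w).unique (h1.congr_of_eventuallyEq h2.symm))
  have hFφ : ∀ w, ‖w‖ < 1 → AnalyticAt ℂ F (φ w) := fun w hw =>
    hF _ (by simpa using hφlt w hw)
  have hball : ∀ {w : ℂ}, w ∈ Metric.ball (0 : ℂ) 1 → ‖w‖ < 1 := fun hw => by simpa using hw
  have hballR : ∀ {w : ℂ}, ‖w‖ < 1 → φ w ∈ Metric.ball (0 : ℂ) r₀ := fun hw => by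
    simpa using hφlt _ hw
  have hφne : ∀ {w : ℂ}, ‖w‖ < 1 → w ≠ 0 → φ w ≠ p := by
    intro w hw hw0 h
    exact hw0 (by rw [← hψφ w hw, h, hψp])
  set f : ℂ → ℂ := F ∘ φ with hf
  have hfan : AnalyticOnNhd ℂ f (Metric.ball 0 1) := fun w hw =>
    (hFφ w (hball hw)).comp (hφan w (hball hw))
  have hf0 : ∀ w ∈ Metric.ball (0 : ℂ) 1, w ≠ 0 → f w ≠ 0 := fun w hw hw0 =>
    ne_zero_of_nodal hF hnc hcov hFp (hballR (hball hw)) (hφne (hball hw) hw0)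
  have h01 : ‖(0 : ℂ)‖ < 1 := by simp
  have hordf : analyticOrderAt f 0 = n := by
    rw [hf, analyticOrderAt_comp_of_deriv_ne_zero (hφan 0 h01) (hφd 0 h01), hφ0, hord]
  obtain ⟨H, hH, hfH⟩ := exists_eq_pow_mul_exp one_pos hfan hf0 hordf
  have hdF : ∀ w, ‖w‖ < 1 → w ≠ 0 → (f w).re = 0 → deriv F (φ w) ≠ 0 := fun w hw hw0 hre =>
    deriv_ne_zero_of_nodal hF hnc hcov ⟨hballR hw, hre⟩ (hφne hw hw0)
  have hdf : ∀ w, ‖w‖ < 1 → deriv f w = deriv F (φ w) * deriv φ w := fun w hw =>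
    deriv_comp w (hFφ w hw).differentiableAt (hφan w hw).differentiableAt
  have hcrit : ∀ w ∈ Metric.ball (0 : ℂ) 1, w ≠ 0 → (f w).re = 0 → deriv f w ≠ 0 := by
    intro w hw hw0 hre
    rw [hdf w (hball hw)]
    exact mul_ne_zero (hdF w (hball hw) hw0 hre) (hφd w (hball hw))
  have hcard : ∀ s > (0 : ℝ), ∀ T : Finset ℂ,
      (∀ w ∈ T, w ∈ Metric.ball (0 : ℂ) 1 ∧ f w = Complex.I * s) → T.card ≤ n := by
    intro s hs T hT
    rw [← Finset.card_image_of_injOn (hφinj.mono fun w hw => (hT w hw).1)]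
    refine card_le_of_nodal hF hnc hcov hFp hp hn hord hs _ fun z hz => ?_
    obtain ⟨w, hw, rfl⟩ := Finset.mem_image.1 hz
    exact ⟨hballR (hball (hT w hw).1), (hT w hw).2⟩
  have hzn : ‖γ t‖ < r₀ := by simpa using (hγ.mem t).1
  set w := ψ (γ t) with hw
  have hw32 : ‖w‖ < 1 / 32 := hψt.trans_le (min_le_left _ _)
  have hwC : ‖w‖ * C ≤ 1 / 2 := by
    have h1 : ‖w‖ ≤ 1 / (2 * C) := hψt.le.trans (min_le_right _ _)
    calc ‖w‖ * C ≤ 1 / (2 * C) * C := by gcongr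
      _ = 1 / 2 := by field_simp
  have hw1 : ‖w‖ < 1 := by linarith
  have hφw : φ w = γ t := hφψ _ hzn
  have hw0 : w ≠ 0 := fun h => htp (by rw [← hφw, h, hφ0])
  have hfre : (f w).re = 0 := by
    rw [hf, Function.comp_apply, hφw]
    exact (hγ.mem t).2
  have hw1' : w ∈ Metric.ball (0 : ℂ) 1 := by simpa using hw1
  obtain ⟨hH1, hH2⟩ := hbound f H hfan hH hn hfH hcrit hcard w hw32.le
  have hQ := norm_pow_mul_exp_quotient_le hn hH hfH hw0 hw1' hH1 hH2 hwC
  have hFγ : F (γ t) ≠ 0 := ne_zero_of_nodal hF hnc hcov hFp (hγ.mem t).1 htp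
  have hdFγ : deriv F (γ t) ≠ 0 := deriv_ne_zero_of_nodal hF hnc hcov (hγ.mem t) htp
  refine (abs_signedCurvature_le hF hγ hFγ hdFγ ((n - 1) / n : ℝ)).trans ?_
  have hFev : F =ᶠ[𝓝 (γ t)] f ∘ ψ := by
    filter_upwards [(isOpen_lt continuous_norm continuous_const).mem_nhds hzn] with y hy
    simp only [hf, Function.comp_apply, hφψ y hy]
  have hψan : AnalyticAt ℂ ψ (γ t) := by
    refine Complex.analyticAt_iff_eventually_differentiableAt.2 ?_
    filter_upwards [(isOpen_lt continuous_norm continuous_const).mem_nhds hzn] with y hy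
    exact (hasDerivAt_discMobius hpn hy).differentiableAt
  have hψd : deriv ψ (γ t) ≠ 0 := deriv_discMobius_ne_zero hpn hzn
  rw [quotient_comp (hfan w hw1') hψan hFev (hcrit w hw1' hw0 hfre) hψd,
    (hasDerivAt_deriv_discMobius (α := α) hpn hzn).deriv, mul_div_cancel_left₀ _ hψd]
  calc _ ≤ 4 * r₀ / (r₀ ^ 2 - ‖p‖ ^ 2) + 4 * r₀ / (r₀ ^ 2 - ‖p‖ ^ 2) * (5 * C) := by
        refine (norm_add_le _ _).trans (add_le_add (norm_two_mul_conj_div_le hpn hzn hw1.le) ?_)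
        rw [norm_mul]
        exact mul_le_mul (norm_deriv_discMobius_le hpn hzn hw1.le) hQ (norm_nonneg _) (by positivity)
    _ = (4 + 20 * C) * r₀ / (r₀ ^ 2 - ‖p‖ ^ 2) := by ring

theorem mainTheorem6 (n : ℕ) :
    ∃ c C : ℝ, 0 < c ∧ c < 1 ∧ 0 < C ∧
      ∀ (r₀ : ℝ) (u : ℂ → ℝ) (p : ℂ) (α : ℝ),
        0 < r₀ →
        InnerProductSpace.HarmonicOnNhd u (Metric.ball 0 r₀) →
        (¬ ∃ a : ℝ, ∀ z ∈ Metric.ball (0 : ℂ) r₀, u z = a) →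
        HasL1BoundaryValue u r₀ →
        p ∈ Metric.ball (0 : ℂ) r₀ →
        u p = 0 →
        HasVanishingOrder u p n →
        HasOnlyNodalCurvesThrough u (Metric.ball 0 r₀) p n →
        ∀ z ∈ (nodalSet u (Metric.ball 0 r₀) \ {p}) ∩ discMobius r₀ p α ⁻¹' Metric.ball 0 c,
          ∀ γ : ℝ → ℂ, IsNodalCurve u (Metric.ball 0 r₀) γ →
            ∀ t : ℝ, γ t = z →
              |signedCurvature γ t| ≤ C * r₀ / (r₀ ^ 2 - ‖p‖ ^ 2) := by
  obtain ⟨c, C, hc, hc1, hC, h⟩ := exists_bound_signedCurvature n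
  refine ⟨c, C, hc, hc1, hC, ?_⟩
  intro r₀ u p α _ hu hnc _ hp hup hord hcov z hz γ hγ t ht
  obtain ⟨F, hF, hFp, hre⟩ := exists_analyticOnNhd_re_eq_of_harmonicOnNhd hu hp hup
  obtain ⟨hn, hordF⟩ := analyticOrderAt_eq_of_hasVanishingOrder (hF p hp) hFp
    (hasVanishingOrder_congr (hre.eventuallyEq_of_mem (Metric.isOpen_ball.mem_nhds hp)) hord)
  refine h r₀ F p α hF ?_ hp hFp hn hordF ?_ γ (hγ.toIsRegularAnalyticCurveIn.congr hre) t ?_ ?_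
  · rintro ⟨a, ha⟩
    exact hnc ⟨a, fun z hz => (hre hz).trans (ha z hz)⟩
  · obtain ⟨δ, hδ, -, hpδ, hcover⟩ := hcov
    intro y hy
    rw [← nodalSet_congr hre, hcover] at hy
    obtain ⟨k, hk⟩ := mem_iUnion.1 hy
    exact ⟨δ k, (hδ k).toIsRegularAnalyticCurveIn.congr hre, hk, hpδ k⟩
  · rw [ht]
    exact hz.1.2
  · rw [ht]
    simpa using hz.2
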